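/- **Concentration and regret of the optimistic renewal score.** Fix $L_{\text{ref}}>0$ and $K$ providers (arms). At each round $t=1,2,\dots$ provider $i$ has a quality $u_i(t)\in[0,1]$ and a latency $\tau_i(t)\ge 0$; the pair $(u_i(t),\tau_i(t))$ is independent of everything that happened before round $t$, and its law does not depend on $t$ (quality and latency of one call, and outcomes of different providers at the same round, may be dependent). Let $u_i^\star,\tau_i^\star$ be the means, and assume that $u_i(t)-u_i^\star$ and $\tau_i(t)-\tau_i^\star$ are sub-Gaussian with variance proxies $\sigma_u^2$ and $\sigma_\tau^2$, i.e. $\mathbb E\,e^{s(u_i(t)-u_i^\star)}\le e^{\sigma_u^2s^2/2}$ for all $s\in\mathbb R$ and likewise for $\tau_i$. Put $\sigma=\max(\sigma_u,\sigma_\tau)$, $V_i^\star=u_i^\star/(1+\tau_i^\star/L_{\text{ref}})$ and $\Delta_i^V=\max_jV_j^\star-V_i^\star$. (a) *Concentration.* For each provider $i$ there is a constant $C_i$ (depending on the law of $(u_i,\tau_i)$, $L_{\text{ref}}$, $\sigma_u$, $\sigma_\tau$, but neither on $n$ nor on $\delta$) such that, for every $n\ge 1$ and every fixed (non-random) set of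 $n$ rounds, the empirical means $\hat u_i,\hat\tau_i$ of the quality and latency of provider $i$ over these rounds satisfy, for every $\delta\in(0,1)$, with probability at least $1-\delta$, $$\left|\frac{\hat u_i}{1+\hat\tau_i/L_{\text{ref}}}-V_i^\star\right|\le (1+L_{\text{ref}}^{-1})\sqrt{\frac{2\sigma^2\log(1/\delta)}{n}}+\frac{C_i}{n}.$$ (b) *Regret.* Assume $\sigma>0$. The optimistic router with exploration coefficient $\beta$ calls at each round $t\ge1$ a provider $I_t$ (chosen using only information available before round $t$, ties broken arbitrarily) that maximizes $$s_i(t)=\frac{\hat u_i}{1+\hat\tau_i/L_{\text{ref}}}+\beta\sqrt{\frac{\log t}{n_i+1}},$$ where $n_i$ is the number of calls of provider $i$ before round $t$ and $\hat u_i,\hat\tau_i$ are the empirical means over these calls (the first term is $0$ if $n_i=0$). Let $R_T=\mathbb E\sum_{t=1}^T\Delta^V_{I_t}$. There is an absolute constant $b_0>0$ such that for every $b\ge b_0$ there is a constant $C>0$, depending only on $b$, such that in every such setting the router with $\beta=b\,(1+L_{\text{ref}}^{-1})\,\sigma$ satisfies $$R_T\le\sum_{i:\Delta_i^V>0}\frac{C\,(1+L_{\text{ref}}^{-1})^2\sigma^2\log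 T}{\Delta_i^V}+o(\log T)\qquad(T\to\infty),$$ where the $o(\log T)$ term may depend on the setting. -/

import Mathlib

open MeasureTheory ProbabilityTheory
open scoped NNReal

namespace RenewalRouting

/-- The renewal score `u / (1 + τ / L)`. -/
noncomputable def renewalScore (L u τ : ℝ) : ℝ := u / (1 + τ / L)

/-- A joint law `ν` of one (quality, latency) observation of a provider: the quality lies in
`[0,1]` and is sub-Gaussian (after centering) with proxy `σu ^ 2`, the latency is nonnegative and
sub-Gaussian (after centering) with proxy `στ ^ 2`. Quality and latency may be dependent. -/
structure IsProviderLaw (ν : Measure (ℝ × ℝ)) (σu στ : ℝ≥0) : Prop where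
  isProbability : IsProbabilityMeasure ν
  quality_mem : ∀ᵐ p ∂ν, p.1 ∈ Set.Icc (0 : ℝ) 1
  latency_nonneg : ∀ᵐ p ∂ν, 0 ≤ p.2
  quality_subgaussian : HasSubgaussianMGF (fun p => p.1 - ∫ q, q.1 ∂ν) (σu ^ 2) ν
  latency_subgaussian : HasSubgaussianMGF (fun p => p.2 - ∫ q, q.2 ∂ν) (στ ^ 2) ν

/-- The true renewal value of a provider: the renewal score of its mean quality and mean
latency. -/
noncomputable def trueValue (L : ℝ) (ν : Measure (ℝ × ℝ)) : ℝ :=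
  renewalScore L (∫ p, p.1 ∂ν) (∫ p, p.2 ∂ν)

/-- The gap between the best renewal value and that of provider `i`. -/
noncomputable def valueGap {K : ℕ} (L : ℝ) (ν : Fin K → Measure (ℝ × ℝ)) (i : Fin K) : ℝ :=
  (⨆ j, trueValue L (ν j)) - trueValue L (ν i)

section Model

variable {Ω : Type*} {m : MeasurableSpace Ω} {K : ℕ}

/-- Stationary `K`-armed feedback. Rounds are numbered `1, 2, …`; `u i t` and `τ i t` are the
quality and the latency that provider `i` yields if it is called at round `t`, and `ℱ t` is the
information available after round `t`. The outcome of each provider at a round is independent of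
the past and has a law that does not depend on the round. Outcomes of different providers at the
same round may be dependent. -/
structure IsStationaryFeedback (μ : Measure Ω) (ℱ : Filtration ℕ m)
    (ν : Fin K → Measure (ℝ × ℝ)) (u τ : Fin K → ℕ → Ω → ℝ) : Prop where
  measurable_quality : ∀ i t, Measurable[ℱ (t + 1)] (u i (t + 1))
  measurable_latency : ∀ i t, Measurable[ℱ (t + 1)] (τ i (t + 1))
  indep_past : ∀ i t,
    Indep (MeasurableSpace.comap (fun ω => (u i (t + 1) ω, τ i (t + 1) ω)) inferInstance) (ℱ t) μ
  law : ∀ i t, μ.map (fun ω => (u i (t + 1) ω, τ i (t + 1) ω)) = ν i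

/-- The average of the observations `x s`, `s ∈ S`; it is `0`, the initial estimate, when there
are no observations. -/
noncomputable def empiricalMean (x : ℕ → Ω → ℝ) (S : Finset ℕ) (ω : Ω) : ℝ :=
  (∑ s ∈ S, x s ω) / (S.card : ℝ)

/-- The plug-in estimator `û / (1 + τ̂ / L)` formed from the observations made at the rounds in
`S`. -/
noncomputable def plugIn (L : ℝ) (u τ : ℕ → Ω → ℝ) (S : Finset ℕ) (ω : Ω) : ℝ :=
  renewalScore L (empiricalMean u S ω) (empiricalMean τ S ω)

/-- The rounds before round `t` at which the router `I` called provider `i`. -/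
def calls (I : ℕ → Ω → Fin K) (i : Fin K) (t : ℕ) (ω : Ω) : Finset ℕ :=
  (Finset.Ico 1 t).filter (fun s => I s ω = i)

/-- The estimated quality gap `max (0, max_j û_j - û_i)` before round `t`. -/
noncomputable def qualityGap (u : Fin K → ℕ → Ω → ℝ) (I : ℕ → Ω → Fin K)
    (i : Fin K) (t : ℕ) (ω : Ω) : ℝ :=
  max 0 ((⨆ j, empiricalMean (u j) (calls I j t ω) ω) - empiricalMean (u i) (calls I i t ω) ω)

/-- The selection score of provider `i` at round `t`, with exploration coefficient `β` and
deflation parameter `lam`. It depends only on the feedback of the providers actually called. -/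
noncomputable def selectionScore (L β lam : ℝ) (u τ : Fin K → ℕ → Ω → ℝ) (I : ℕ → Ω → Fin K)
    (i : Fin K) (t : ℕ) (ω : Ω) : ℝ :=
  plugIn L (u i) (τ i) (calls I i t ω) ω +
    β * √(Real.log t / ((calls I i t ω).card + 1)) / (1 + lam * qualityGap u I i t ω)

/-- `I t` is the provider called at round `t ≥ 1`: it is decided from the information available
before round `t` and maximizes the selection score (ties are broken in any such way). -/
structure IsScoreRouter (ℱ : Filtration ℕ m) (L β lam : ℝ) (u τ : Fin K → ℕ → Ω → ℝ)
    (I : ℕ → Ω → Fin K) : Prop where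
  predictable : ∀ t, Measurable[ℱ t] (I (t + 1))
  maximal : ∀ t, 1 ≤ t → ∀ ω i,
    selectionScore L β lam u τ I i t ω ≤ selectionScore L β lam u τ I (I t ω) t ω

/-- The expected regret after `T` rounds, measured in renewal value. -/
noncomputable def regret (L : ℝ) (ν : Fin K → Measure (ℝ × ℝ)) (μ : Measure Ω)
    (I : ℕ → Ω → Fin K) (T : ℕ) : ℝ :=
  ∫ ω, ∑ t ∈ Finset.Icc 1 T, valueGap L ν (I t ω) ∂μ

end Model

end RenewalRouting

/-!
Everything rests on one identity. Write `V` for the true renewal value of a provider and put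
`W = (u - u⋆) - (V / L) (τ - τ⋆)` (`linearNoise`). For any empirical means with nonnegative
latency, the error of the plug-in estimator is exactly the average of `W` divided by
`1 + τ̂ / L ≥ 1`. Hence it is bounded by the average of `W`, with no second-order remainder. The
noise `W` is sub-Gaussian with scale `σu + (V / L) στ`, which is at most `M = (1 + L⁻¹) σ`, and is
strictly smaller than `M` unless `W` vanishes almost surely (`IsProviderLaw.noiseProxy_lt`).

*Concentration.* The bound asks for the two-sided probability `δ` at the level belonging to the
one-sided Chernoff bound, for every `δ ∈ (0, 1)`. With `δ = exp (-x ^ 2 / 2)` this says that a sum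
of `n` copies of `W` exceeds `M x √n + C` in absolute value with probability at most
`exp (-x ^ 2 / 2)` (`exists_forall_tail_le`, for standardized noise). Three ranges of `x` are
treated separately.
* For large `x`, the strict inequality between the scale of `W` and `M` absorbs the factor `2` in
  the two-sided Chernoff bound.
* For `x` in a compact subset of `(0, ∞)` and large `n`, the central limit theorem reduces the claim
  to the Gaussian tail bound `P(|N| ≥ a) ≤ exp (-a ^ 2 / 2)`, applied with `M` larger than the
  standard deviation (`exists_tail_le_of_mem_Icc`).
* For small `x` the claim is a lower bound of order `x ^ 2` for the probability of a small deviation.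
  A Fourier argument gives more: the sum lies within `R` of its mean with probability at least of
  order `R / √n`, for `R` between a constant and a small multiple of `√n`
  (`exists_mass_lower_bound`). It tests the law against a minorant of the indicator of an interval
  whose Fourier transform has compact support (`bump`), so that only the characteristic function near
  the origin matters. The constant lower limit of `R` is what the term `C / n` pays for.

The finitely many remaining `n` are covered by enlarging `C`.

*Regret.* The noise collected by a predictable rule, compensated by the sub-Gaussian exponent, is an
exponential supermartingale (`IsSubgaussianNoise.lintegral_exp_sum_le_one`). On the event that a
provider has been called exactly `n` times this gives a Chernoff bound with the multiplier optimal
for `n`, and a union bound over `n < t` shows that the average noise exceeds the exploration bonus at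
round `t` with probability at most `2 / t ^ 2` as soon as `b ≥ 4`. Off these events a suboptimal
provider is called only while its bonus is at least half its gap, that is, at most
`4 β ^ 2 log T / Δ ^ 2` times up to an additive constant. The `o(log T)` term can therefore be taken
constant.
-/

namespace RenewalRouting
open Filter Topology Set

/-! ### A band-limited minorant of the indicator of an interval -/

/-- The function on `[0, 1]` whose cosine transform is a minorant of a multiple of the indicator
of `[-5, 5]`. -/
noncomputable def bumpKernel (t : ℝ) : ℝ :=
  (1 - t) * Real.cos (Real.pi * t) + Real.sin (Real.pi * t)

/-- The cosine transform of `bumpKernel`: a band-limited function bounded by `2` and nonpositive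
outside `[-5, 5]`. -/
noncomputable def bump (x : ℝ) : ℝ := ∫ t in (0 : ℝ)..1, bumpKernel t * Real.cos (t * x)

lemma continuous_bumpKernel : Continuous bumpKernel := by unfold bumpKernel; fun_prop

lemma abs_bumpKernel_le {t : ℝ} (h0 : 0 ≤ t) (h1 : t ≤ 1) : |bumpKernel t| ≤ 2 := by
  have hc := Real.abs_cos_le_one (Real.pi * t)
  have hs := Real.abs_sin_le_one (Real.pi * t)
  have h : |(1 - t) * Real.cos (Real.pi * t)| ≤ 1 := by
    rw [abs_mul, abs_of_nonneg (by linarith)]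
    nlinarith [abs_nonneg (Real.cos (Real.pi * t))]
  exact (abs_add_le _ _).trans (by linarith)

lemma bump_le_two (x : ℝ) : bump x ≤ 2 := by
  have h := intervalIntegral.norm_integral_le_of_norm_le_const (a := (0 : ℝ)) (b := 1) (C := 2)
    (f := fun t => bumpKernel t * Real.cos (t * x)) (fun t ht => by
      rw [Set.uIoc_of_le zero_le_one] at ht
      rw [Real.norm_eq_abs, abs_mul]
      have := abs_bumpKernel_le ht.1.le ht.2
      nlinarith [Real.abs_cos_le_one (t * x), abs_nonneg (Real.cos (t * x)),
        abs_nonneg (bumpKernel t)])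
  have h2 := (Real.le_norm_self _).trans h
  simpa [bump] using h2

lemma bump_eq {x : ℝ} (ha : Real.pi + x ≠ 0) (hb : Real.pi - x ≠ 0) :
    bump x = (1 + Real.cos x) / 2 * (1 / (Real.pi + x) ^ 2 + 1 / (Real.pi - x) ^ 2
      + 1 / (Real.pi + x) + 1 / (Real.pi - x)) := by
  set a := Real.pi + x with hadef
  set b := Real.pi - x with hbdef
  have hderiv (c : ℝ) (hc : c ≠ 0) (t : ℝ) : HasDerivAt
      (fun t => ((1 - t) * Real.sin (c * t) / c - Real.cos (c * t) / c ^ 2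
        - Real.cos (c * t) / c) / 2)
      (((1 - t) * Real.cos (c * t) + Real.sin (c * t)) / 2) t := by
    have hl : HasDerivAt (fun t : ℝ => c * t) c t := by
      simpa using (hasDerivAt_id t).const_mul c
    have hs := hl.sin
    have hco := hl.cos
    have h1 : HasDerivAt (fun t : ℝ => 1 - t) (-1) t := by
      simpa using (hasDerivAt_id t).const_sub 1
    refine ((((h1.mul hs).div_const c).sub (hco.div_const (c ^ 2))).sub
      (hco.div_const c)).div_const 2 |>.congr_deriv ?_
    field_simp
    ring
  -- the product formulas turn the integrand into a sum of two terms of the form in `hderiv`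
  have hint : ∀ t ∈ Set.uIcc (0 : ℝ) 1, HasDerivAt
      (fun t => ((1 - t) * Real.sin (a * t) / a - Real.cos (a * t) / a ^ 2
        - Real.cos (a * t) / a) / 2 + ((1 - t) * Real.sin (b * t) / b
        - Real.cos (b * t) / b ^ 2 - Real.cos (b * t) / b) / 2)
      (bumpKernel t * Real.cos (t * x)) t := by
    intro t _
    refine ((hderiv a ha t).add (hderiv b hb t)).congr_deriv ?_
    have e1 : a * t = Real.pi * t + t * x := by rw [hadef]; ring
    have e2 : b * t = Real.pi * t - t * x := by rw [hbdef]; ring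
    rw [e1, e2, Real.cos_add, Real.cos_sub, Real.sin_add, Real.sin_sub, bumpKernel]
    ring
  rw [bump, intervalIntegral.integral_eq_sub_of_hasDerivAt hint
    ((continuous_bumpKernel.mul (by fun_prop)).intervalIntegrable _ _)]
  have c1 : Real.cos a = - Real.cos x := by
    rw [hadef, add_comm, Real.cos_add_pi]
  have c2 : Real.cos b = - Real.cos x := by
    rw [hbdef, Real.cos_pi_sub]
  simp only [mul_one, mul_zero, Real.cos_zero, Real.sin_zero, c1, c2]
  ring

lemma bump_nonpos {x : ℝ} (hx : 5 ≤ |x|) : bump x ≤ 0 := by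
  have hp := Real.pi_gt_three
  have hp' := Real.pi_lt_d2
  have hx2 : 25 ≤ x ^ 2 := by rw [← sq_abs]; nlinarith
  have hab : (Real.pi + x) * (Real.pi - x) < 0 := by nlinarith
  have ha : Real.pi + x ≠ 0 := by rintro h; rw [h] at hab; simp at hab
  have hb : Real.pi - x ≠ 0 := by rintro h; rw [h] at hab; simp at hab
  rw [bump_eq ha hb]
  refine mul_nonpos_of_nonneg_of_nonpos (by linarith [Real.neg_one_le_cos x]) ?_
  have e : 1 / (Real.pi + x) ^ 2 + 1 / (Real.pi - x) ^ 2 + 1 / (Real.pi + x) + 1 / (Real.pi - x)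
      = 2 * (Real.pi ^ 2 + x ^ 2 + Real.pi * (Real.pi ^ 2 - x ^ 2))
        / ((Real.pi + x) * (Real.pi - x)) ^ 2 := by
    field_simp
    ring
  rw [e]
  refine div_nonpos_of_nonpos_of_nonneg ?_ (by positivity)
  have h1 : Real.pi ^ 2 ≤ 10 := by nlinarith
  nlinarith [mul_nonneg (by linarith : (0:ℝ) ≤ Real.pi - 3) (by linarith : (0:ℝ) ≤ x ^ 2 - 25)]

/-- A band-limited minorant turns a bound on the characteristic function into a lower bound on
the mass near `0`. -/
lemma integral_charFun_le_measure (ρ : Measure ℝ) [IsProbabilityMeasure ρ] {R : ℝ} (hR : 0 < R) :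
    ∫ t in (0 : ℝ)..1, bumpKernel t * (charFun ρ (t / R)).re ≤ 2 * ρ.real {y | |y| ≤ 5 * R} := by
  have hre (s : ℝ) : (charFun ρ s).re = ∫ y, Real.cos (s * y) ∂ρ := by
    rw [charFun_apply_real]
    have : Integrable (fun y : ℝ => Complex.exp (s * y * Complex.I)) ρ := by
      refine Integrable.of_bound (C := 1) (by fun_prop) (ae_of_all _ fun y => ?_)
      rw [← Complex.ofReal_mul, Complex.norm_exp_ofReal_mul_I]
    rw [← RCLike.re_eq_complex_re, ← integral_re this]
    refine integral_congr_ae (ae_of_all _ fun y => ?_)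
    simp only [RCLike.re_eq_complex_re]
    rw [← Complex.ofReal_mul, Complex.exp_ofReal_mul_I_re]
  have hsw : ∫ t in (0 : ℝ)..1, bumpKernel t * (charFun ρ (t / R)).re
      = ∫ y, bump (y / R) ∂ρ := by
    simp_rw [hre, bump, ← integral_const_mul]
    rw [intervalIntegral_integral_swap]
    · refine integral_congr_ae (ae_of_all _ fun y => ?_)
      refine intervalIntegral.integral_congr fun t _ => ?_
      congr 2
      ring
    · have : IsFiniteMeasure (volume.restrict (Set.uIoc (0:ℝ) 1)) := by
        rw [Set.uIoc_of_le zero_le_one]; infer_instance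
      refine Integrable.of_bound (C := 2) ?_ ?_
      · have h := continuous_bumpKernel
        refine Continuous.aestronglyMeasurable ?_
        unfold Function.uncurry
        fun_prop
      · have hmeas : ∀ᵐ t ∂(volume.restrict (Set.uIoc (0:ℝ) 1)), |bumpKernel t| ≤ 2 := by
          rw [Set.uIoc_of_le zero_le_one]
          filter_upwards [ae_restrict_mem measurableSet_Ioc] with t ht
          exact abs_bumpKernel_le ht.1.le ht.2
        have h2 := (Measure.quasiMeasurePreserving_fst (μ := volume.restrict (Set.uIoc (0:ℝ) 1))
          (ν := ρ)).ae hmeas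
        filter_upwards [h2] with z hz
        simp only [Function.uncurry]
        rw [Real.norm_eq_abs, abs_mul]
        nlinarith [Real.abs_cos_le_one (z.1 / R * z.2), abs_nonneg (Real.cos (z.1 / R * z.2)),
          abs_nonneg (bumpKernel z.1)]
  rw [hsw]
  have hm : MeasurableSet {y : ℝ | |y| ≤ 5 * R} := measurableSet_le (by fun_prop) (by fun_prop)
  have hle : ∀ y, bump (y / R) ≤ {y : ℝ | |y| ≤ 5 * R}.indicator (fun _ => (2 : ℝ)) y := by
    intro y
    by_cases hy : |y| ≤ 5 * R
    · rw [Set.indicator_of_mem (by exact hy)]; exact bump_le_two _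
    · rw [Set.indicator_of_notMem (by exact hy)]
      apply bump_nonpos
      rw [abs_div, abs_of_pos hR, le_div_iff₀ hR]
      exact (not_le.1 hy).le
  have hib : Integrable ({y : ℝ | |y| ≤ 5 * R}.indicator (fun _ => (2 : ℝ))) ρ :=
    (integrable_const 2).indicator hm
  by_cases hbi : Integrable (fun y => bump (y / R)) ρ
  · refine (integral_mono hbi hib hle).trans ?_
    rw [integral_indicator_const _ hm, smul_eq_mul, mul_comm]
  · rw [integral_undef hbi]; positivity

/-! ### Lower bounds for the mass near the mean -/

/-- Near the origin the characteristic function of a standardized law is dominated by a Gaussian. -/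
lemma exists_norm_charFun_le (ν : Measure ℝ) [IsProbabilityMeasure ν]
    (h0 : ∫ x, x ∂ν = 0) (h1 : ∫ x, x ^ 2 ∂ν = 1) :
    ∃ η > 0, ∀ u : ℝ, |u| ≤ η → ‖charFun ν u‖ ≤ Real.exp (-u ^ 2 / 4) := by
  have h := taylor_charFun_two (P := ν) (X := id) aemeasurable_id (by simpa using h0)
    (by simpa using h1)
  rw [Measure.map_id] at h
  have h2 := h.def (c := 1 / 4) (by norm_num)
  obtain ⟨η, hη, hball⟩ := Metric.eventually_nhds_iff.1 h2
  refine ⟨min (η / 2) 1, by positivity, fun u hu => ?_⟩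
  have hu1 : |u| ≤ 1 := hu.trans (min_le_right _ _)
  have hu2 : dist u 0 < η := by
    rw [Real.dist_eq, sub_zero]; exact (hu.trans (min_le_left _ _)).trans_lt (by linarith)
  have h3 := hball hu2
  have hsq : u ^ 2 ≤ 1 := by rw [← sq_abs]; nlinarith [abs_nonneg u]
  have h4 : ‖(1 - (u : ℂ) ^ 2 / 2)‖ = 1 - u ^ 2 / 2 := by
    rw [show (1 - (u : ℂ) ^ 2 / 2) = ((1 - u ^ 2 / 2 : ℝ) : ℂ) by push_cast; ring,
      Complex.norm_real, Real.norm_eq_abs, abs_of_nonneg (by linarith)]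
  have h5 := norm_le_norm_add_norm_sub' (charFun ν u) (1 - (u : ℂ) ^ 2 / 2)
  rw [h4] at h5
  have h6 : ‖u ^ 2‖ = u ^ 2 := by simp
  rw [h6] at h3
  have h7 := Real.add_one_le_exp (-u ^ 2 / 4)
  linarith

/-- **Local lower bound.** The sum of `n` independent copies of a standardized variable lies within
`R` of its mean with probability at least of order `R / √n`, for all `R` between a constant and a
small multiple of `√n`. -/
lemma exists_mass_lower_bound (ν : Measure ℝ) [IsProbabilityMeasure ν]
    (h0 : ∫ x, x ∂ν = 0) (h1 : ∫ x, x ^ 2 ∂ν = 1) :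
    ∃ c > 0, ∃ κ₀ > 0, ∃ R₀ > 0, ∃ n₀ : ℕ, 1 ≤ n₀ ∧ ∀ n : ℕ, n₀ ≤ n →
      ∀ ρ : Measure ℝ, IsProbabilityMeasure ρ → (∀ t, charFun ρ t = charFun ν t ^ n) →
        ∀ R : ℝ, R₀ ≤ R → R ≤ κ₀ * √n → c * (R / √n) ≤ ρ.real {y | |y| ≤ R} := by
  obtain ⟨η, hη, hφ⟩ := exists_norm_charFun_le ν h0 h1
  -- `κ` stands for `R / √n` up to a factor; the lower bound on `κ √n` keeps the arguments of the
  -- characteristic function in the interval `[-η, η]`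
  let l : Filter (ℕ × ℝ) := (atTop ×ˢ 𝓝[>] (0 : ℝ)) ⊓ 𝓟 {p | 1 / η ≤ p.2 * √p.1}
  let F : ℕ × ℝ → ℝ → ℝ := fun p => (Ioc 0 (1 / p.2)).indicator
    (fun s => bumpKernel (p.2 * s) * (charFun ν ((√p.1)⁻¹ * s) ^ p.1).re)
  have hlpos : ∀ᶠ p in l, 0 < p.2 ∧ 1 ≤ p.1 ∧ 1 / η ≤ p.2 * √p.1 := by
    have a1 : ∀ᶠ p in (atTop ×ˢ 𝓝[>] (0 : ℝ) : Filter (ℕ × ℝ)), 1 ≤ p.1 ∧ 0 < p.2 :=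
      (eventually_ge_atTop 1).prod_mk self_mem_nhdsWithin
    filter_upwards [a1.filter_mono inf_le_left, mem_inf_of_right (mem_principal_self _)]
      with p hp hp2
    exact ⟨hp.2, hp.1, hp2⟩
  have ht1 : Tendsto (fun p : ℕ × ℝ => p.1) l atTop := tendsto_fst.mono_left inf_le_left
  have ht2 : Tendsto (fun p : ℕ × ℝ => p.2) l (𝓝[>] 0) := tendsto_snd.mono_left inf_le_left
  have key : Tendsto (fun p => ∫ s, F p s) l
      (𝓝 (∫ s, (Ioi (0 : ℝ)).indicator (fun s => Real.exp (-s ^ 2 / 2)) s)) := by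
    refine tendsto_integral_filter_of_dominated_convergence
      (fun s => 2 * Real.exp (-(1 / 4) * s ^ 2)) ?_ ?_ ?_ ?_
    · refine Eventually.of_forall fun p => ?_
      refine AEStronglyMeasurable.indicator ?_ measurableSet_Ioc
      refine Measurable.aestronglyMeasurable ?_
      have := continuous_bumpKernel.measurable
      have h3 : Measurable (charFun ν) := measurable_charFun
      exact (this.comp (by fun_prop)).mul
        (Complex.measurable_re.comp ((h3.comp (by fun_prop)).pow_const _))
    · filter_upwards [hlpos] with p ⟨hp0, hp1, hp2⟩
      refine ae_of_all _ fun s => ?_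
      simp only [F]
      by_cases hs : s ∈ Ioc 0 (1 / p.2)
      · rw [indicator_of_mem hs, norm_mul]
        have hn : (0 : ℝ) < p.1 := by exact_mod_cast hp1
        have hsn : 0 < √(p.1 : ℝ) := Real.sqrt_pos.2 hn
        have hk : ‖bumpKernel (p.2 * s)‖ ≤ 2 := by
          refine abs_bumpKernel_le (by have := hs.1; positivity) ?_
          have := hs.2
          rw [le_div_iff₀ hp0] at this
          linarith
        have hu : |(√(p.1 : ℝ))⁻¹ * s| ≤ η := by
          rw [abs_of_pos (by have := hs.1; positivity), inv_mul_le_iff₀ hsn]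
          rw [div_le_iff₀ hη] at hp2
          refine hs.2.trans ?_
          rw [div_le_iff₀ hp0]
          linarith
        have hc : ‖(charFun ν ((√(p.1 : ℝ))⁻¹ * s) ^ p.1).re‖ ≤ Real.exp (-(1 / 4) * s ^ 2) := by
          refine (Complex.abs_re_le_norm _).trans ?_
          rw [norm_pow]
          refine (pow_le_pow_left₀ (norm_nonneg _) (hφ _ hu) _).trans ?_
          rw [← Real.exp_nat_mul, mul_pow, inv_pow, Real.sq_sqrt hn.le]
          refine Real.exp_le_exp.2 (le_of_eq ?_)
          field_simp
        gcongr
      · rw [indicator_of_notMem hs, norm_zero]; positivity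
    · exact (integrable_exp_neg_mul_sq (by norm_num)).const_mul 2
    · refine ae_of_all _ fun s => ?_
      by_cases hs : 0 < s
      · rw [indicator_of_mem (by exact hs)]
        have hlt : ∀ᶠ p in l, s ∈ Ioc 0 (1 / p.2) := by
          have a3 : ∀ᶠ κ in 𝓝[>] (0 : ℝ), κ < 1 / s :=
            nhdsWithin_le_nhds (eventually_lt_nhds (by positivity))
          filter_upwards [ht2.eventually a3, hlpos] with p hp hq
          refine ⟨hs, ?_⟩
          rw [lt_div_iff₀ hs] at hp
          rw [le_div_iff₀ hq.1]
          linarith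
        have hb : Tendsto (fun p : ℕ × ℝ => bumpKernel (p.2 * s)) l (𝓝 1) := by
          have e : bumpKernel 0 = 1 := by simp [bumpKernel]
          rw [← e]
          refine (continuous_bumpKernel.tendsto 0).comp ?_
          have := (ht2.mono_right nhdsWithin_le_nhds).mul_const s
          simpa using this
        have hc : Tendsto (fun p : ℕ × ℝ => (charFun ν ((√p.1)⁻¹ * s) ^ p.1).re) l
            (𝓝 (Real.exp (-s ^ 2 / 2))) := by
          have := tendsto_charFun_inv_sqrt_mul_pow (P := ν) (X := id) aemeasurable_id
            (by simpa using h0) (by simpa using h1) s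
          rw [Measure.map_id] at this
          have h4 := (Complex.continuous_re.tendsto _).comp (this.comp ht1)
          have e : (Complex.exp (-(s : ℂ) ^ 2 / 2)).re = Real.exp (-s ^ 2 / 2) := by
            rw [← Complex.exp_ofReal_re]; push_cast; rfl
          rw [e] at h4
          exact h4
        have hprod := hb.mul hc
        rw [one_mul] at hprod
        refine hprod.congr' ?_
        filter_upwards [hlt] with p hp
        simp only [F]
        rw [indicator_of_mem hp]
      · rw [indicator_of_notMem (by exact hs)]
        refine tendsto_const_nhds.congr fun p => ?_
        simp only [F]
        rw [indicator_of_notMem (fun h => hs h.1)]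
  set J := ∫ s, (Ioi (0 : ℝ)).indicator (fun s => Real.exp (-s ^ 2 / 2)) s with hJ
  have hJpos : 0 < J := by
    rw [hJ, integral_indicator measurableSet_Ioi]
    have e : ∀ s : ℝ, Real.exp (-s ^ 2 / 2) = Real.exp (-(1 / 2) * s ^ 2) := fun s => by ring_nf
    simp_rw [e]
    rw [integral_gaussian_Ioi]
    positivity
  have hev : ∀ᶠ p in l, J / 2 < ∫ s, F p s := key.eventually_const_lt (by linarith)
  have hev2 : ∀ᶠ p in (atTop ×ˢ 𝓝[>] (0 : ℝ) : Filter (ℕ × ℝ)),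
      1 / η ≤ p.2 * √p.1 → J / 2 < ∫ s, F p s := by
    rw [eventually_inf_principal] at hev
    exact hev
  obtain ⟨A, hA, B, hB, hAB⟩ := eventually_prod_iff.1 hev2
  obtain ⟨n₁, hn₁⟩ := eventually_atTop.1 hA
  obtain ⟨κ₁, hκ₁, hκB⟩ := mem_nhdsGT_iff_exists_Ioc_subset.1 hB
  have hκ₁' : 0 < κ₁ := hκ₁
  refine ⟨J / 20, by positivity, 5 * κ₁, by positivity, 5 / η, by positivity, max n₁ 1,
    le_max_right _ _, fun n hn ρ _ hρ R hR1 hR2 => ?_⟩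
  have hn1 : (0 : ℝ) < n := by
    exact_mod_cast lt_of_lt_of_le Nat.one_pos ((le_max_right _ _).trans hn)
  have hsn : 0 < √(n : ℝ) := Real.sqrt_pos.2 hn1
  have hRpos : 0 < R := lt_of_lt_of_le (by positivity) hR1
  set κ := R / 5 / √n with hκ
  have hκpos : 0 < κ := by positivity
  have hκle : κ ≤ κ₁ := by
    rw [hκ, div_le_iff₀ hsn]; linarith
  have hκn : κ * √n = R / 5 := by rw [hκ]; field_simp
  have hmain : J / 2 < ∫ s, F (n, κ) s := by
    refine hAB (hn₁ n ((le_max_left _ _).trans hn)) (hκB ⟨hκpos, hκle⟩) ?_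
    simp only
    rw [hκn]
    rw [div_le_iff₀ hη] at hR1
    rw [div_le_iff₀ hη]
    linarith
  have hint : κ * ∫ s, F (n, κ) s
      = ∫ t in (0 : ℝ)..1, bumpKernel t * (charFun ρ (t / (R / 5))).re := by
    have e1 : ∫ s, F (n, κ) s = ∫ s in (0 : ℝ)..(1 / κ),
        bumpKernel (κ * s) * (charFun ρ (κ * s / (R / 5))).re := by
      simp only [F]
      rw [integral_indicator measurableSet_Ioc, intervalIntegral.integral_of_le (by positivity)]
      refine integral_congr_ae (ae_of_all _ fun s => ?_)
      simp only
      rw [hρ, ← hκn]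
      congr 4
      field_simp
    rw [e1, intervalIntegral.mul_integral_comp_mul_left
      (f := fun t => bumpKernel t * (charFun ρ (t / (R / 5))).re)]
    rw [mul_zero, mul_one_div_cancel hκpos.ne']
  have hfin := integral_charFun_le_measure ρ (R := R / 5) (by positivity)
  rw [← hint, mul_div_cancel₀ R (by norm_num : (5 : ℝ) ≠ 0)] at hfin
  have : κ * (J / 2) ≤ κ * ∫ s, F (n, κ) s := by gcongr
  have e3 : R / √n = 5 * κ := by rw [hκ]; field_simp
  rw [e3]
  linarith

/-! ### Tail bounds for sums of independent copies -/

/-- The two-sided Gaussian tail bound, without a factor `2` in front of the exponential. -/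
lemma gaussianReal_abs_ge_le {a : ℝ} (ha : 0 ≤ a) :
    gaussianReal 0 1 {y | a ≤ |y|} ≤ ENNReal.ofReal (Real.exp (-a ^ 2 / 2)) := by
  rw [gaussianReal_apply_eq_integral _ one_ne_zero]
  refine ENNReal.ofReal_le_ofReal ?_
  have hm : MeasurableSet {y : ℝ | a ≤ |y|} := measurableSet_le (by fun_prop) (by fun_prop)
  rw [← integral_indicator hm]
  have hpdf (y : ℝ) : gaussianPDFReal 0 1 y = (√(2 * Real.pi))⁻¹ * Real.exp (-(1 / 2) * y ^ 2) := by
    rw [gaussianPDFReal]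
    simp only [NNReal.coe_one, mul_one, sub_zero]
    congr 2
    ring
  have e1 : ∀ y : ℝ, {y : ℝ | a ≤ |y|}.indicator (gaussianPDFReal 0 1) y
      = (fun z : ℝ => (Ici a).indicator
        (fun z => (√(2 * Real.pi))⁻¹ * Real.exp (-(1 / 2) * z ^ 2)) z) |y| := by
    intro y
    by_cases hy : a ≤ |y|
    · rw [indicator_of_mem (by exact hy)]
      simp only
      rw [indicator_of_mem (by exact hy), hpdf, sq_abs]
    · rw [indicator_of_notMem (by exact hy)]
      simp only
      rw [indicator_of_notMem (by exact hy)]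
  simp_rw [e1]
  rw [integral_comp_abs, setIntegral_indicator measurableSet_Ici]
  have e2 : ∫ z in Ioi 0 ∩ Ici a, (√(2 * Real.pi))⁻¹ * Real.exp (-(1 / 2) * z ^ 2)
      ≤ ∫ z in Ici a, (√(2 * Real.pi))⁻¹ * Real.exp (-(1 / 2) * z ^ 2) := by
    refine setIntegral_mono_set
      ((integrable_exp_neg_mul_sq (by norm_num)).const_mul _).integrableOn ?_ ?_
    · exact ae_of_all _ fun z => by simp only [Pi.zero_apply]; positivity
    · exact inter_subset_right.eventuallyLE
  have e3 : ∫ z in Ici a, (√(2 * Real.pi))⁻¹ * Real.exp (-(1 / 2) * z ^ 2)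
      ≤ (√(2 * Real.pi))⁻¹ * (Real.exp (-a ^ 2 / 2) * (√(2 * Real.pi) / 2)) := by
    rw [integral_const_mul, integral_Ici_eq_integral_Ioi]
    gcongr
    have e4 := (measurePreserving_add_right volume a).setIntegral_preimage_emb
      (measurableEmbedding_addRight a) (fun z : ℝ => Real.exp (-(1 / 2) * z ^ 2)) (Ioi a)
    rw [preimage_add_const_Ioi, sub_self] at e4
    rw [← e4]
    have e5 := integral_gaussian_Ioi (1 / 2)
    rw [show Real.pi / (1 / 2) = 2 * Real.pi by ring] at e5
    rw [← e5, ← integral_const_mul]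
    have hi := (integrable_exp_neg_mul_sq (b := 1 / 2) (by norm_num))
    refine setIntegral_mono_on (hi.comp_add_right a).integrableOn (hi.const_mul _).integrableOn
      measurableSet_Ioi fun z hz => ?_
    rw [← Real.exp_add]
    refine Real.exp_le_exp.2 ?_
    have : 0 ≤ z * a := mul_nonneg (le_of_lt hz) ha
    nlinarith
  have hpos : 0 < √(2 * Real.pi) := by positivity
  calc _ ≤ 2 * ((√(2 * Real.pi))⁻¹ * (Real.exp (-a ^ 2 / 2) * (√(2 * Real.pi) / 2))) := by
        linarith
    _ = Real.exp (-a ^ 2 / 2) := by field_simp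

/-- **Moderate deviations.** By the central limit theorem, `n`-fold sums of a standardized law
satisfy the Gaussian bound `exp (-x ^ 2 / 2)` at any inflated level `M x √n`, `M > 1`, uniformly
for `x` in a compact subset of `(0, ∞)`, once `n` is large. -/
lemma exists_tail_le_of_mem_Icc (ν : Measure ℝ) [IsProbabilityMeasure ν]
    (h0 : ∫ x, x ∂ν = 0) (h1 : ∫ x, x ^ 2 ∂ν = 1) {M x₁ x₂ : ℝ} (hM : 1 < M) (hx₁ : 0 < x₁) :
    ∃ n₀ : ℕ, ∀ n : ℕ, n₀ ≤ n → ∀ ρ : Measure ℝ, IsProbabilityMeasure ρ →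
      (∀ t, charFun ρ t = charFun ν t ^ n) → ∀ x ∈ Icc x₁ x₂,
        ρ.real {y | M * x * √n < |y|} ≤ Real.exp (-x ^ 2 / 2) := by
  -- otherwise a sequence of violations at levels converging to some `x₀ > 0` contradicts the
  -- convergence of the rescaled laws to the standard Gaussian law
  by_contra! hcon
  choose N hN ρ hρ hchar x hx hlt using hcon
  have hmeas (k : ℕ) : Measurable (fun y : ℝ => (√(N k : ℝ))⁻¹ * y) := by fun_prop
  have hprob (k : ℕ) : IsProbabilityMeasure ((ρ k).map (fun y => (√(N k : ℝ))⁻¹ * y)) :=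
    have := hρ k; Measure.isProbabilityMeasure_map (hmeas k).aemeasurable
  let ms (k : ℕ) : ProbabilityMeasure ℝ := ⟨(ρ k).map (fun y => (√(N k : ℝ))⁻¹ * y), hprob k⟩
  let G : ProbabilityMeasure ℝ := ⟨gaussianReal 0 1, inferInstance⟩
  have hNt : Tendsto N atTop atTop := tendsto_atTop_mono hN tendsto_id
  have hlim : Tendsto ms atTop (𝓝 G) := by
    rw [ProbabilityMeasure.tendsto_iff_tendsto_charFun]
    intro t
    have h2 := tendsto_charFun_inv_sqrt_mul_pow (P := ν) (X := id) aemeasurable_id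
      (by simpa using h0) (by simpa using h1) t
    rw [Measure.map_id] at h2
    have h3 := h2.comp hNt
    have e : charFun (G : Measure ℝ) t = Complex.exp (-(t : ℂ) ^ 2 / 2) := by
      simp [G, charFun_gaussianReal, neg_div]
    rw [e]
    refine h3.congr fun k => ?_
    simp only [ms, Function.comp_apply, ProbabilityMeasure.coe_mk]
    rw [charFun_map_mul, hchar]
  obtain ⟨x₀, hx₀, θ, hθ, hxθ⟩ := isCompact_Icc.tendsto_subseq hx
  have hx₀pos : 0 < x₀ := hx₁.trans_le hx₀.1
  -- an intermediate factor makes room for replacing `x (θ j)` by its limit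
  set M' := (1 + M) / 2 with hM'
  have hM'1 : 1 < M' := by linarith
  have hM'2 : M' < M := by linarith
  have hclosed : IsClosed {y : ℝ | M' * x₀ ≤ |y|} := isClosed_le (by fun_prop) (by fun_prop)
  have hls := ProbabilityMeasure.limsup_measure_closed_le_of_tendsto
    (hlim.comp hθ.tendsto_atTop) hclosed
  have hev : ∀ᶠ j in atTop, ENNReal.ofReal (Real.exp (-(x (θ j)) ^ 2 / 2))
      ≤ ((ms ∘ θ) j : Measure ℝ) {y : ℝ | M' * x₀ ≤ |y|} := by
    have h5 : ∀ᶠ j in atTop, M' * x₀ < M * x (θ j) :=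
      (hxθ.const_mul M).eventually_const_lt (mul_lt_mul_of_pos_right hM'2 hx₀pos)
    filter_upwards [h5, (hNt.comp hθ.tendsto_atTop).eventually_ge_atTop 1] with j hj hj1
    have := hρ (θ j)
    have hs : 0 < √(N (θ j) : ℝ) := Real.sqrt_pos.2 (by exact_mod_cast hj1)
    change _ ≤ ((ρ (θ j)).map (fun y => (√(N (θ j) : ℝ))⁻¹ * y)) _
    rw [Measure.map_apply (hmeas _) hclosed.measurableSet]
    refine (ENNReal.ofReal_le_ofReal (hlt (θ j)).le).trans ?_
    rw [ofReal_measureReal]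
    refine measure_mono fun y hy => ?_
    simp only [mem_ofPred_eq, mem_preimage] at hy ⊢
    rw [abs_mul, abs_of_pos (inv_pos.2 hs), le_inv_mul_iff₀ hs]
    nlinarith
  have hlimc : Tendsto (fun j => ENNReal.ofReal (Real.exp (-(x (θ j)) ^ 2 / 2))) atTop
      (𝓝 (ENNReal.ofReal (Real.exp (-x₀ ^ 2 / 2)))) := by
    refine (ENNReal.continuous_ofReal.tendsto _).comp ?_
    have hc : Continuous (fun x : ℝ => Real.exp (-x ^ 2 / 2)) := by fun_prop
    exact (hc.tendsto x₀).comp hxθ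
  have h6 := (hlimc.limsup_eq.symm.le.trans (limsup_le_limsup hev)).trans
    (hls.trans (gaussianReal_abs_ge_le (by positivity)))
  rw [ENNReal.ofReal_le_ofReal_iff (Real.exp_pos _).le, Real.exp_le_exp] at h6
  have : x₀ ^ 2 < (M' * x₀) ^ 2 := by
    apply pow_lt_pow_left₀ _ hx₀pos.le two_ne_zero
    nlinarith
  linarith

/-- **Concentration at the one-sided level.** Let `ν` be a standardized law and let `ρ` range over
the laws of `n`-fold sums of independent copies. If `ρ` has two-sided sub-Gaussian tails with proxy
`n c`, `c < M ^ 2`, then the two-sided deviation event at level `M x √n`, enlarged by a constant `C`,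
has probability at most `exp (-x ^ 2 / 2)`, for *all* `x > 0` and all `n`. -/
theorem exists_forall_tail_le (ν : Measure ℝ) [IsProbabilityMeasure ν]
    (h0 : ∫ x, x ∂ν = 0) (h1 : ∫ x, x ^ 2 ∂ν = 1) {c M : ℝ} (hc : 1 ≤ c) (hM0 : 0 ≤ M)
    (hcM : c < M ^ 2) :
    ∃ C : ℝ, ∀ n : ℕ, 1 ≤ n → ∀ ρ : Measure ℝ, IsProbabilityMeasure ρ →
      (∀ t, charFun ρ t = charFun ν t ^ n) →
      (∀ a : ℝ, 0 ≤ a → ρ.real {y | a < |y|} ≤ 2 * Real.exp (-a ^ 2 / (2 * (n * c)))) →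
      ∀ x : ℝ, 0 < x → ρ.real {y | M * x * √n + C < |y|} ≤ Real.exp (-x ^ 2 / 2) := by
  have hM1 : 1 < M := by nlinarith
  have hcpos : 0 < c := by linarith
  obtain ⟨a, ha, κ, hκ, R₀, hR₀, n₁, hn₁1, hn₁⟩ := exists_mass_lower_bound ν h0 h1
  -- above `x₂` the slack in the sub-Gaussian exponent absorbs the factor `2`
  obtain ⟨x₂, hx₂pos, hx₂⟩ : ∃ x₂ > 0, ∀ x : ℝ, x₂ ≤ x →
      2 * Real.exp (-(M * x) ^ 2 / (2 * c)) ≤ Real.exp (-x ^ 2 / 2) := by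
    set d := (M ^ 2 / c - 1) / 2 with hd
    have hdpos : 0 < d := by
      have : 1 < M ^ 2 / c := (one_lt_div hcpos).2 hcM
      linarith
    refine ⟨max 1 (1 / d), by positivity, fun x hx => ?_⟩
    have hx1 : 1 ≤ x := (le_max_left _ _).trans hx
    have hx2 : 1 ≤ d * x := by
      have := (le_max_right _ _).trans hx
      rw [div_le_iff₀ hdpos] at this
      linarith
    have h2 : (2 : ℝ) ≤ Real.exp (d * x ^ 2) := by
      have := Real.add_one_le_exp (d * x ^ 2)
      nlinarith
    calc 2 * Real.exp (-(M * x) ^ 2 / (2 * c))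
        ≤ Real.exp (d * x ^ 2) * Real.exp (-(M * x) ^ 2 / (2 * c)) := by gcongr
      _ = Real.exp (-x ^ 2 / 2) := by
        rw [← Real.exp_add, hd]
        congr 1
        field_simp
        ring
  -- below `x₁` the local lower bound applies
  set x₁ := min (κ / (2 * M)) (2 * a * M) with hx₁
  have hx₁pos : 0 < x₁ := by
    have : 0 < M := by linarith
    positivity
  obtain ⟨n₂, hn₂⟩ := exists_tail_le_of_mem_Icc ν h0 h1 (x₂ := x₂) hM1 hx₁pos
  obtain ⟨n₃, hn₃⟩ := exists_nat_ge ((2 * R₀ / κ) ^ 2)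
  set n₀ := max n₁ (max n₂ n₃) with hn₀
  -- for the finitely many remaining `n` a large constant suffices
  obtain ⟨C₀, hC₀, hC₀'⟩ : ∃ C₀ ≥ 0, 2 * Real.exp (-C₀ ^ 2 / (2 * (n₀ * c)))
      ≤ Real.exp (-x₂ ^ 2 / 2) := by
    have hn₀pos : (0 : ℝ) < n₀ := by
      exact_mod_cast lt_of_lt_of_le Nat.one_pos (hn₁1.trans (le_max_left _ _))
    refine ⟨√(2 * (n₀ * c) * (x₂ ^ 2 / 2 + 1)), Real.sqrt_nonneg _, ?_⟩
    rw [Real.sq_sqrt (by positivity)]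
    have h3 : (2 : ℝ) ≤ Real.exp 1 := by have := Real.add_one_le_exp (1 : ℝ); linarith
    calc _ ≤ Real.exp 1 * Real.exp (-(2 * (n₀ * c) * (x₂ ^ 2 / 2 + 1)) / (2 * (n₀ * c))) := by
          gcongr
      _ = Real.exp (-x₂ ^ 2 / 2) := by
        rw [← Real.exp_add]
        congr 1
        field_simp
        ring
  refine ⟨max R₀ C₀, fun n hn ρ _ hchar htail x hx => ?_⟩
  have hnpos : (0 : ℝ) < n := by exact_mod_cast hn
  have hsn : 0 < √(n : ℝ) := Real.sqrt_pos.2 hnpos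
  have hCpos : 0 ≤ max R₀ C₀ := hR₀.le.trans (le_max_left _ _)
  have hMx : 0 < M * x := by positivity
  have hmono {b : ℝ} (hb : b ≤ M * x * √n + max R₀ C₀) :
      ρ.real {y | M * x * √n + max R₀ C₀ < |y|} ≤ ρ.real {y | b < |y|} :=
    measureReal_mono fun y hy => lt_of_le_of_lt hb hy
  rcases le_or_gt x₂ x with hxx | hxx
  · refine (hmono (b := M * x * √n) (by linarith)).trans ((htail _ (by positivity)).trans ?_)
    refine le_trans (le_of_eq ?_) (hx₂ x hxx)
    rw [mul_pow _ (√(n : ℝ)), Real.sq_sqrt hnpos.le]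
    congr 2
    field_simp
  rcases le_or_gt n₀ n with hnn | hnn
  · have hnn1 : n₁ ≤ n := (le_max_left _ _).trans hnn
    have hnn2 : n₂ ≤ n := ((le_max_left _ _).trans (le_max_right _ _)).trans hnn
    have hnn3 : n₃ ≤ n := ((le_max_right _ _).trans (le_max_right _ _)).trans hnn
    rcases le_or_gt x₁ x with hxx1 | hxx1
    · exact (hmono (b := M * x * √n) (by linarith)).trans
        (hn₂ n hnn2 ρ inferInstance hchar x ⟨hxx1, hxx.le⟩)
    · set R := M * x * √n + R₀ with hR
      have hsqrt : 2 * R₀ / κ ≤ √n := by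
        refine Real.le_sqrt_of_sq_le (hn₃.trans ?_)
        exact_mod_cast hnn3
      have hRle : R ≤ κ * √n := by
        have h4 : x < κ / (2 * M) := hxx1.trans_le (min_le_left _ _)
        rw [lt_div_iff₀ (by positivity)] at h4
        rw [div_le_iff₀ hκ] at hsqrt
        have h5 : M * x * √n ≤ κ / 2 * √n := by gcongr; linarith
        linarith
      have h6 := hn₁ n hnn1 ρ inferInstance hchar R (by rw [hR]; linarith [mul_pos hMx hsn]) hRle
      have h7 : x ^ 2 / 2 ≤ a * (R / √n) := by
        have h8 : M * x ≤ R / √n := by rw [le_div_iff₀ hsn]; linarith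
        have h9 : x < 2 * a * M := hxx1.trans_le (min_le_right _ _)
        calc x ^ 2 / 2 ≤ a * (M * x) := by nlinarith
          _ ≤ _ := by gcongr
      have h10 : ρ.real {y | R < |y|} = 1 - ρ.real {y | |y| ≤ R} := by
        have hm : MeasurableSet {y : ℝ | |y| ≤ R} := measurableSet_le (by fun_prop) (by fun_prop)
        rw [← probReal_compl_eq_one_sub hm]
        congr 1
        ext y
        simp
      have h11 := hmono (b := R) (by rw [hR]; linarith [le_max_left R₀ C₀])
      have h12 := Real.add_one_le_exp (-x ^ 2 / 2)
      linarith
  · refine (hmono (b := C₀) (by nlinarith [le_max_right R₀ C₀, mul_pos hMx hsn])).trans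
      ((htail _ hC₀).trans ?_)
    calc 2 * Real.exp (-C₀ ^ 2 / (2 * (n * c))) ≤ 2 * Real.exp (-C₀ ^ 2 / (2 * (n₀ * c))) := by
          have h13 : (n : ℝ) ≤ n₀ := by exact_mod_cast hnn.le
          have h14 : C₀ ^ 2 / (2 * (n₀ * c)) ≤ C₀ ^ 2 / (2 * (n * c)) := by gcongr
          rw [neg_div, neg_div]
          gcongr
      _ ≤ Real.exp (-x₂ ^ 2 / 2) := hC₀'
      _ ≤ Real.exp (-x ^ 2 / 2) := by
          rw [neg_div, neg_div]
          gcongr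

/-- The variance of a sub-Gaussian variable is at most its variance proxy. -/
lemma integral_sq_le_of_hasSubgaussianMGF {Ω : Type*} {m : MeasurableSpace Ω} {μ : Measure Ω}
    [IsProbabilityMeasure μ] {X : Ω → ℝ} {c : ℝ≥0} (h : HasSubgaussianMGF X c μ) :
    ∫ ω, X ω ^ 2 ∂μ ≤ c := by
  have hcosh (y : ℝ) : 1 + y ^ 2 / 2 ≤ Real.cosh y := by
    have h1 : (y / 2) ^ 2 ≤ Real.sinh (y / 2) ^ 2 := by
      rw [sq_le_sq, Real.abs_sinh]
      exact Real.self_le_sinh_iff.2 (abs_nonneg _)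
    have h2 := Real.cosh_two_mul (y / 2)
    have h3 := Real.cosh_sq (y / 2)
    rw [mul_div_cancel₀ y two_ne_zero] at h2
    nlinarith
  have hsq : Integrable (fun ω => X ω ^ 2) μ := (h.memLp 2).integrable_sq
  set V := ∫ ω, X ω ^ 2 ∂μ with hV
  have key (t : ℝ) : 1 + t ^ 2 * V / 2 ≤ Real.exp (c * t ^ 2 / 2) := by
    have i1 := h.integrable_exp_mul t
    have i2 := h.integrable_exp_mul (-t)
    have l1 : ∫ ω, (1 + t ^ 2 / 2 * X ω ^ 2) ∂μ
        ≤ ∫ ω, (Real.exp (t * X ω) + Real.exp (-t * X ω)) / 2 ∂μ := by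
      refine integral_mono ((integrable_const 1).add (hsq.const_mul _)) ((i1.add i2).div_const 2)
        fun ω => ?_
      have := hcosh (t * X ω)
      rw [Real.cosh_eq] at this
      simp only [neg_mul]
      linarith [mul_pow t (X ω) 2]
    rw [integral_div, integral_add i1 i2, integral_add (integrable_const 1) (hsq.const_mul _),
      integral_const_mul] at l1
    have m1 := h.mgf_le t
    have m2 := h.mgf_le (-t)
    rw [neg_sq] at m2
    simp only [mgf] at m1 m2
    simp only [integral_const, probReal_univ, smul_eq_mul, mul_one] at l1
    linarith
  by_contra! hlt
  -- compare second-order terms at a small `t`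
  have hc0 : (0 : ℝ) ≤ c := c.2
  have hV0 : 0 < V := hc0.trans_lt hlt
  obtain ⟨s, hs, hs1, hs2⟩ : ∃ s : ℝ, 0 < s ∧ c * s ≤ 1 ∧ c * c * s < V - c := by
    refine ⟨min (1 / (c + 1)) ((V - c) / (c * c + 1)), by
      have : 0 < V - c := by linarith
      positivity, ?_, ?_⟩
    · calc (c : ℝ) * _ ≤ c * (1 / (c + 1)) := by gcongr; exact min_le_left _ _
        _ ≤ 1 := by rw [mul_one_div, div_le_one (by positivity)]; linarith
    · calc (c : ℝ) * c * _ ≤ c * c * ((V - c) / (c * c + 1)) := by gcongr; exact min_le_right _ _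
        _ < V - c := by
          rw [mul_div_assoc', div_lt_iff₀ (by positivity)]
          nlinarith
  have h4 := key (√(2 * s))
  rw [Real.sq_sqrt (by positivity)] at h4
  have e : (c : ℝ) * (2 * s) / 2 = c * s := by ring
  rw [e] at h4
  have h5 := Real.abs_exp_sub_one_sub_id_le (x := c * s)
    (by rw [abs_of_nonneg (by positivity)]; exact hs1)
  have h6 := (abs_le.1 h5).2
  nlinarith

/-! ### Sub-Gaussian noise under predictable sampling -/

/-- An adapted sequence `W 1, W 2, …` of sub-Gaussian variables with proxy `c`, each independent of
the past. The value `W 0` plays no role. -/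
structure IsSubgaussianNoise {Ω : Type*} {m : MeasurableSpace Ω} (μ : Measure Ω)
    (ℱ : Filtration ℕ m) (W : ℕ → Ω → ℝ) (c : ℝ≥0) : Prop where
  measurable : ∀ t, Measurable[ℱ (t + 1)] (W (t + 1))
  indep_past : ∀ t, Indep (MeasurableSpace.comap (W (t + 1)) inferInstance) (ℱ t) μ
  subgaussian : ∀ t, HasSubgaussianMGF (W (t + 1)) c μ

section Sampling

variable {Ω : Type*} {m : MeasurableSpace Ω} {μ : Measure Ω} {ℱ : Filtration ℕ m}
  {W : ℕ → Ω → ℝ} {c : ℝ≥0}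

lemma IsSubgaussianNoise.neg (h : IsSubgaussianNoise μ ℱ W c) :
    IsSubgaussianNoise μ ℱ (fun t ω => -W t ω) c where
  measurable t := (h.measurable t).neg
  indep_past t := by
    refine indep_of_indep_of_le_left (h.indep_past t) ?_
    rw [← measurable_iff_comap_le]
    exact (comap_measurable _).neg
  subgaussian t := (h.subgaussian t).neg

/-- The increments selected by a predictable rule, compensated by the sub-Gaussian exponent, form an
exponential supermartingale started at `1`. -/
lemma IsSubgaussianNoise.lintegral_exp_sum_le_one [IsProbabilityMeasure μ]
    (h : IsSubgaussianNoise μ ℱ W c) (p : ℕ → Ω → Prop) [∀ t ω, Decidable (p t ω)]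
    (hp : ∀ t, MeasurableSet[ℱ t] {ω | p (t + 1) ω}) (s : ℝ) (t : ℕ) :
    ∫⁻ ω, ENNReal.ofReal (Real.exp
      (∑ r ∈ Finset.Ico 1 (t + 1) with p r ω, (s * W r ω - c * s ^ 2 / 2))) ∂μ ≤ 1 := by
  have hmeas (t : ℕ) : Measurable[ℱ t] (fun ω =>
      ∑ r ∈ Finset.Ico 1 (t + 1) with p r ω, (s * W r ω - c * s ^ 2 / 2)) := by
    simp_rw [Finset.sum_filter]
    refine Finset.measurable_fun_sum _ fun r hr => ?_
    obtain ⟨hr1, hr2⟩ := Finset.mem_Ico.1 hr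
    obtain ⟨q, rfl⟩ : ∃ q, r = q + 1 := ⟨r - 1, by omega⟩
    refine Measurable.ite (ℱ.mono (by omega : q ≤ t) _ (hp q)) ?_ measurable_const
    exact (((h.measurable q).mono (ℱ.mono (by omega)) le_rfl).const_mul s).sub_const _
  induction t with
  | zero => simp
  | succ t ih =>
    set Z : Ω → ENNReal := fun ω => ENNReal.ofReal (Real.exp
      (∑ r ∈ Finset.Ico 1 (t + 1) with p r ω, (s * W r ω - c * s ^ 2 / 2))) with hZ
    have hZm : Measurable[ℱ t] Z :=
      ENNReal.measurable_ofReal.comp (Real.measurable_exp.comp (hmeas t))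
    set Y : Ω → ENNReal :=
      fun ω => ENNReal.ofReal (Real.exp (s * W (t + 1) ω - c * s ^ 2 / 2)) with hY
    set A : Set Ω := {ω | p (t + 1) ω} with hA
    have hAm : MeasurableSet[ℱ t] A := hp t
    have hsplit (ω : Ω) : ENNReal.ofReal (Real.exp
        (∑ r ∈ Finset.Ico 1 (t + 1 + 1) with p r ω, (s * W r ω - c * s ^ 2 / 2)))
        = A.indicator Z ω * Y ω + Aᶜ.indicator Z ω := by
      rw [Finset.sum_filter, Finset.sum_Ico_succ_top (by omega), ← Finset.sum_filter]
      by_cases hω : p (t + 1) ω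
      · rw [if_pos hω, indicator_of_mem (by exact hω), indicator_of_notMem (by exact not_not.2 hω),
          add_zero, Real.exp_add, ENNReal.ofReal_mul (Real.exp_pos _).le]
      · rw [if_neg hω, indicator_of_notMem (by exact hω), indicator_of_mem (by exact hω),
          zero_mul, zero_add, add_zero]
    have hYle : ∫⁻ ω, Y ω ∂μ ≤ 1 := by
      have hi : Integrable (fun ω => Real.exp (s * W (t + 1) ω - c * s ^ 2 / 2)) μ := by
        simp_rw [Real.exp_sub]
        exact ((h.subgaussian t).integrable_exp_mul s).div_const _
      rw [hY, ← ofReal_integral_eq_lintegral_ofReal hi (ae_of_all _ fun _ => (Real.exp_pos _).le),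
        ENNReal.ofReal_le_one]
      simp_rw [Real.exp_sub]
      rw [integral_div, div_le_one (Real.exp_pos _)]
      exact (h.subgaussian t).mgf_le s
    have hWm : Measurable (W (t + 1)) := (h.measurable t).mono (ℱ.le _) le_rfl
    have hprod : ∫⁻ ω, A.indicator Z ω * Y ω ∂μ = (∫⁻ ω, A.indicator Z ω ∂μ) * ∫⁻ ω, Y ω ∂μ := by
      refine lintegral_mul_eq_lintegral_mul_lintegral_of_independent_measurableSpace
        (ℱ.le t) hWm.comap_le (h.indep_past t).symm (hZm.indicator hAm) ?_
      have : Measurable fun w : ℝ => ENNReal.ofReal (Real.exp (s * w - c * s ^ 2 / 2)) := by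
        fun_prop
      exact this.comp (comap_measurable _)
    have hAm' : MeasurableSet A := ℱ.le t _ hAm
    have hZm' : Measurable Z := hZm.mono (ℱ.le t) le_rfl
    simp_rw [hsplit]
    rw [lintegral_add_right _ (hZm'.indicator hAm'.compl), hprod]
    calc _ ≤ (∫⁻ ω, A.indicator Z ω ∂μ) * 1 + ∫⁻ ω, Aᶜ.indicator Z ω ∂μ := by gcongr
      _ = ∫⁻ ω, Z ω ∂μ := by
        rw [mul_one, lintegral_indicator hAm', lintegral_indicator hAm'.compl,
          lintegral_add_compl _ hAm']
      _ ≤ 1 := ih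

/-- One-sided Chernoff bound under predictable sampling, on the event that exactly `n` rounds have
been selected. -/
lemma IsSubgaussianNoise.measureReal_lt_sum_le [IsProbabilityMeasure μ]
    (h : IsSubgaussianNoise μ ℱ W c) (hc : 0 < c) (p : ℕ → Ω → Prop)
    [∀ t ω, Decidable (p t ω)] (hp : ∀ t, MeasurableSet[ℱ t] {ω | p (t + 1) ω})
    (t : ℕ) {n : ℕ} (hn : 1 ≤ n) {a : ℝ} (ha : 0 ≤ a) :
    μ.real {ω | (Finset.filter (p · ω) (Finset.Ico 1 (t + 1))).card = n ∧
      a < ∑ r ∈ Finset.Ico 1 (t + 1) with p r ω, W r ω} ≤ Real.exp (-a ^ 2 / (2 * (n * c))) := by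
  -- the Chernoff bound with the multiplier that is optimal for `n` observations
  set s := a / (n * c) with hs
  have hnpos : (0 : ℝ) < n := by exact_mod_cast hn
  have hcpos : (0 : ℝ) < c := by exact_mod_cast hc
  have hs0 : 0 ≤ s := by positivity
  have hm : Measurable (fun ω => ENNReal.ofReal (Real.exp
      (∑ r ∈ Finset.Ico 1 (t + 1) with p r ω, (s * W r ω - c * s ^ 2 / 2)))) := by
    refine ENNReal.measurable_ofReal.comp (Real.measurable_exp.comp ?_)
    simp_rw [Finset.sum_filter]
    refine Finset.measurable_fun_sum _ fun r hr => ?_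
    obtain ⟨hr1, hr2⟩ := Finset.mem_Ico.1 hr
    obtain ⟨q, rfl⟩ : ∃ q, r = q + 1 := ⟨r - 1, by omega⟩
    refine Measurable.ite (ℱ.le q _ (hp q)) ?_ measurable_const
    exact (((h.measurable q).mono (ℱ.le _) le_rfl).const_mul s).sub_const _
  have hmk := mul_meas_ge_le_lintegral (μ := μ) hm
    (ENNReal.ofReal (Real.exp (a ^ 2 / (2 * (n * c)))))
  have hle := hmk.trans (h.lintegral_exp_sum_le_one p hp s t)
  have hsub : {ω | (Finset.filter (p · ω) (Finset.Ico 1 (t + 1))).card = n ∧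
      a < ∑ r ∈ Finset.Ico 1 (t + 1) with p r ω, W r ω}
      ⊆ {ω | ENNReal.ofReal (Real.exp (a ^ 2 / (2 * (n * c)))) ≤ ENNReal.ofReal (Real.exp
      (∑ r ∈ Finset.Ico 1 (t + 1) with p r ω, (s * W r ω - c * s ^ 2 / 2)))} := by
    rintro ω ⟨hω1, hω2⟩
    refine ENNReal.ofReal_le_ofReal (Real.exp_le_exp.2 ?_)
    rw [Finset.sum_sub_distrib, ← Finset.mul_sum, Finset.sum_const, hω1, nsmul_eq_mul]
    have e : a ^ 2 / (2 * (n * c)) = s * a - n * (c * s ^ 2 / 2) := by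
      rw [hs]; field_simp; ring
    rw [e]
    gcongr
  have hfin := (mul_le_mul_right (measure_mono (μ := μ) hsub)
    (ENNReal.ofReal (Real.exp (a ^ 2 / (2 * (n * c)))))).trans hle
  rw [← ofReal_measureReal, ← ENNReal.ofReal_mul (Real.exp_pos _).le, ENNReal.ofReal_le_one] at hfin
  rw [neg_div, Real.exp_neg]
  rwa [← one_div, le_div_iff₀' (Real.exp_pos _)]

/-- Two-sided Chernoff bound under predictable sampling, on the event that exactly `n` rounds have
been selected. -/
lemma IsSubgaussianNoise.measureReal_lt_abs_sum_le [IsProbabilityMeasure μ]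
    (h : IsSubgaussianNoise μ ℱ W c) (hc : 0 < c) (p : ℕ → Ω → Prop)
    [∀ t ω, Decidable (p t ω)] (hp : ∀ t, MeasurableSet[ℱ t] {ω | p (t + 1) ω})
    (t : ℕ) {n : ℕ} (hn : 1 ≤ n) {a : ℝ} (ha : 0 ≤ a) :
    μ.real {ω | (Finset.filter (p · ω) (Finset.Ico 1 (t + 1))).card = n ∧
      a < |∑ r ∈ Finset.Ico 1 (t + 1) with p r ω, W r ω|}
      ≤ 2 * Real.exp (-a ^ 2 / (2 * (n * c))) := by
  have h1 := h.measureReal_lt_sum_le hc p hp t hn ha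
  have h2 := h.neg.measureReal_lt_sum_le hc p hp t hn ha
  refine (measureReal_mono (fun ω hω => ?_)).trans
    ((measureReal_union_le _ _).trans ((add_le_add h1 h2).trans (two_mul _).symm.le))
  rcases lt_abs.1 hω.2 with hω2 | hω2
  · exact Or.inl ⟨hω.1, hω2⟩
  · exact Or.inr ⟨hω.1, by rwa [Finset.sum_neg_distrib]⟩

/-- Over a deterministic set of rounds the noise adds up as for independent identically distributed
variables. -/
lemma IsSubgaussianNoise.charFun_map_sum [IsProbabilityMeasure μ]
    (h : IsSubgaussianNoise μ ℱ W c) {ν : Measure ℝ} (hlaw : ∀ t, μ.map (W (t + 1)) = ν)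
    (S : Finset ℕ) (hS : ∀ s ∈ S, 1 ≤ s) (x : ℝ) :
    charFun (μ.map (fun ω => ∑ s ∈ S, W s ω)) x = charFun ν x ^ S.card := by
  induction S using Finset.induction_on_max with
  | empty => simp [Measure.map_const]
  | insert a S hmax ih =>
    have ha : a ∉ S := fun ha => lt_irrefl _ (hmax a ha)
    obtain ⟨b, rfl⟩ : ∃ b, a = b + 1 :=
      ⟨a - 1, by have := hS a (Finset.mem_insert_self _ _); omega⟩
    have hSm : Measurable[ℱ b] (fun ω => ∑ s ∈ S, W s ω) := by
      refine Finset.measurable_fun_sum _ fun r hr => ?_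
      have hr1 := hS r (Finset.mem_insert_of_mem hr)
      have hr2 := hmax r hr
      obtain ⟨q, rfl⟩ : ∃ q, r = q + 1 := ⟨r - 1, by omega⟩
      exact (h.measurable q).mono (ℱ.mono (by omega)) le_rfl
    have hWm : Measurable (W (b + 1)) := (h.measurable b).mono (ℱ.le _) le_rfl
    have hind : IndepFun (W (b + 1)) (fun ω => ∑ s ∈ S, W s ω) μ := by
      rw [IndepFun_iff_Indep]
      exact indep_of_indep_of_le_right (h.indep_past b) hSm.comap_le
    simp_rw [Finset.sum_insert ha]
    rw [hind.charFun_map_fun_add_eq_mul hWm.aemeasurable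
      (hSm.mono (ℱ.le _) le_rfl).aemeasurable, Pi.mul_apply, hlaw,
      ih fun s hs => hS s (Finset.mem_insert_of_mem hs), Finset.card_insert_of_notMem ha, pow_succ,
      mul_comm]

end Sampling

/-! ### Concentration of the plug-in estimator -/

section Provider

variable {ν : Measure (ℝ × ℝ)} {σu στ : ℝ≥0} {L : ℝ}

lemma IsProviderLaw.integrable_quality (h : IsProviderLaw ν σu στ) :
    Integrable (fun p : ℝ × ℝ => p.1) ν := by
  have := h.isProbability
  exact (h.quality_subgaussian.integrable.add (integrable_const (∫ q, q.1 ∂ν))).congr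
    (ae_of_all _ fun p => sub_add_cancel _ _)

lemma IsProviderLaw.integrable_latency (h : IsProviderLaw ν σu στ) :
    Integrable (fun p : ℝ × ℝ => p.2) ν := by
  have := h.isProbability
  exact (h.latency_subgaussian.integrable.add (integrable_const (∫ q, q.2 ∂ν))).congr
    (ae_of_all _ fun p => sub_add_cancel _ _)

lemma IsProviderLaw.meanQuality_nonneg (h : IsProviderLaw ν σu στ) : 0 ≤ ∫ p, p.1 ∂ν :=
  integral_nonneg_of_ae (h.quality_mem.mono fun _ hp => hp.1)

lemma IsProviderLaw.meanQuality_le_one (h : IsProviderLaw ν σu στ) : ∫ p, p.1 ∂ν ≤ 1 := by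
  have := h.isProbability
  have h1 := integral_mono_ae h.integrable_quality (integrable_const (1 : ℝ))
    (h.quality_mem.mono fun _ hp => hp.2)
  simpa using h1

lemma IsProviderLaw.meanLatency_nonneg (h : IsProviderLaw ν σu στ) : 0 ≤ ∫ p, p.2 ∂ν :=
  integral_nonneg_of_ae h.latency_nonneg

lemma IsProviderLaw.trueValue_nonneg (h : IsProviderLaw ν σu στ) (hL : 0 < L) :
    0 ≤ trueValue L ν := by
  have h1 := h.meanQuality_nonneg
  have h2 := h.meanLatency_nonneg
  unfold trueValue renewalScore
  positivity

lemma IsProviderLaw.trueValue_le_one (h : IsProviderLaw ν σu στ) (hL : 0 < L) :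
    trueValue L ν ≤ 1 := by
  have h1 := h.meanQuality_le_one
  have h2 : 0 ≤ (∫ p, p.2 ∂ν) / L := div_nonneg h.meanLatency_nonneg hL.le
  unfold trueValue renewalScore
  rw [div_le_one (by positivity)]
  linarith

/-- The linear combination of centered quality and centered latency that governs the error of the
plug-in estimator: the numerator of the difference of two renewal scores. -/
noncomputable def linearNoise (L : ℝ) (ν : Measure (ℝ × ℝ)) (p : ℝ × ℝ) : ℝ :=
  (p.1 - ∫ q, q.1 ∂ν) - trueValue L ν / L * (p.2 - ∫ q, q.2 ∂ν)

lemma measurable_linearNoise (L : ℝ) (ν : Measure (ℝ × ℝ)) : Measurable (linearNoise L ν) := by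
  unfold linearNoise; fun_prop

/-- The error of a renewal score with nonnegative latency is dominated by the corresponding linear
error. The linear expression is exact up to division by `1 + τ / L ≥ 1`, so no second-order
remainder appears. -/
lemma IsProviderLaw.abs_renewalScore_sub_trueValue_le (h : IsProviderLaw ν σu στ) (hL : 0 < L)
    (u : ℝ) {τ : ℝ} (hτ : 0 ≤ τ) :
    |renewalScore L u τ - trueValue L ν| ≤ |linearNoise L ν (u, τ)| := by
  have h2 := h.meanLatency_nonneg
  have hD : 1 ≤ 1 + τ / L := by have := div_nonneg hτ hL.le; linarith
  have hDs : 0 < 1 + (∫ q, q.2 ∂ν) / L := by positivity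
  have e : renewalScore L u τ - trueValue L ν = linearNoise L ν (u, τ) / (1 + τ / L) := by
    have hv : trueValue L ν * (1 + (∫ q, q.2 ∂ν) / L) = ∫ q, q.1 ∂ν := by
      unfold trueValue renewalScore
      exact div_mul_cancel₀ _ hDs.ne'
    rw [eq_div_iff (by linarith), sub_mul]
    unfold renewalScore
    rw [div_mul_cancel₀ _ (by linarith)]
    unfold linearNoise
    rw [← hv]
    field_simp
    ring
  rw [e, abs_div, abs_of_pos (by linarith : 0 < 1 + τ / L)]
  exact div_le_self (abs_nonneg _) hD

/-- The linear noise is sub-Gaussian; since quality and latency may be dependent, the square roots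
of the proxies add up. -/
lemma IsProviderLaw.hasSubgaussianMGF_linearNoise (h : IsProviderLaw ν σu στ) (hL : 0 < L) :
    HasSubgaussianMGF (linearNoise L ν) ((σu + (trueValue L ν / L).toNNReal * στ) ^ 2) ν := by
  have h1 := h.quality_subgaussian.add (h.latency_subgaussian.const_mul (-(trueValue L ν / L)))
  have e1 : NNReal.sqrt (σu ^ 2) = σu := NNReal.sqrt_sq _
  have hv : 0 ≤ trueValue L ν / L := div_nonneg (h.trueValue_nonneg hL) hL.le
  have e2 : NNReal.sqrt (⟨(-(trueValue L ν / L)) ^ 2, sq_nonneg _⟩ * στ ^ 2)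
      = (trueValue L ν / L).toNNReal * στ := by
    rw [NNReal.sqrt_eq_iff_eq_sq, mul_pow]
    congr 1
    ext
    rw [NNReal.coe_pow, Real.coe_toNNReal _ hv]
    exact neg_sq (trueValue L ν / L)
  rw [e1, e2] at h1
  refine h1.congr (ae_of_all _ fun p => ?_)
  simp only [linearNoise]
  ring

lemma sq_noiseProxy_le {v : ℝ} (hv0 : 0 ≤ v) (hL : 0 < L) (σu στ : ℝ≥0) :
    (((σu + (v / L).toNNReal * στ) ^ 2 : ℝ≥0) : ℝ)
      ≤ ((1 + v * L⁻¹) * max (σu : ℝ) στ) ^ 2 := by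
  push_cast
  rw [Real.coe_toNNReal _ (by positivity)]
  have h1 : (σu : ℝ) ≤ max (σu : ℝ) στ := le_max_left _ _
  have h2 : (στ : ℝ) ≤ max (σu : ℝ) στ := le_max_right _ _
  have h3 : 0 ≤ v * L⁻¹ := by positivity
  have h4 : v / L * στ ≤ v * L⁻¹ * max (σu : ℝ) στ := by
    rw [div_eq_mul_inv]; gcongr
  gcongr
  linarith

/-- If the renewal value is maximal, then quality is almost surely `1` and latency almost surely
`0`. -/
lemma IsProviderLaw.linearNoise_ae_eq_zero (h : IsProviderLaw ν σu στ) (hL : 0 < L)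
    (hv : trueValue L ν = 1) : linearNoise L ν =ᵐ[ν] 0 := by
  have := h.isProbability
  have h1 := h.meanQuality_le_one
  have h2 := h.meanLatency_nonneg
  have h3 : 0 ≤ (∫ p, p.2 ∂ν) / L := div_nonneg h2 hL.le
  have h4 : ∫ p, p.1 ∂ν = 1 + (∫ p, p.2 ∂ν) / L := by
    unfold trueValue renewalScore at hv
    rwa [div_eq_one_iff_eq (by positivity)] at hv
  have hq : ∫ p, p.1 ∂ν = 1 := by linarith
  have hl : ∫ p, p.2 ∂ν = 0 := by
    have : (∫ p, p.2 ∂ν) / L = 0 := by linarith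
    simpa [hL.ne'] using this
  have a1 : (fun p : ℝ × ℝ => 1 - p.1) =ᵐ[ν] 0 := by
    have hi : Integrable (fun p : ℝ × ℝ => 1 - p.1) ν :=
      (integrable_const 1).sub h.integrable_quality
    rw [← integral_eq_zero_iff_of_nonneg_ae (h.quality_mem.mono fun p hp => by
      simpa using hp.2) hi, integral_sub (integrable_const 1) h.integrable_quality, hq]
    simp
  have a2 : (fun p : ℝ × ℝ => p.2) =ᵐ[ν] 0 := by
    rwa [← integral_eq_zero_iff_of_nonneg_ae h.latency_nonneg h.integrable_latency]
  filter_upwards [a1, a2] with p hp1 hp2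
  simp only [Pi.zero_apply] at hp1 hp2 ⊢
  rw [linearNoise, hq, hl, hp2]
  linarith

/-- There is strict room between the proxy of the linear noise and the constant of the concentration
bound, unless the noise vanishes. -/
lemma IsProviderLaw.noiseProxy_lt (h : IsProviderLaw ν σu στ) (hL : 0 < L)
    (hV : 0 < ∫ p, linearNoise L ν p ^ 2 ∂ν) :
    (((σu + (trueValue L ν / L).toNNReal * στ) ^ 2 : ℝ≥0) : ℝ)
      < ((1 + L⁻¹) * max (σu : ℝ) στ) ^ 2 := by
  have := h.isProbability
  have hv0 := h.trueValue_nonneg hL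
  have hv1 : trueValue L ν < 1 := by
    refine lt_of_le_of_ne (h.trueValue_le_one hL) fun hv => hV.ne' ?_
    rw [← integral_zero (ℝ × ℝ) ℝ (μ := ν)]
    refine integral_congr_ae ((h.linearNoise_ae_eq_zero hL hv).mono fun p hp => ?_)
    simp [hp]
  have h1 := integral_sq_le_of_hasSubgaussianMGF (h.hasSubgaussianMGF_linearNoise hL)
  have h2 := sq_noiseProxy_le hv0 hL σu στ
  refine h2.trans_lt ?_
  have hσ : 0 < max (σu : ℝ) στ := by
    by_contra hcon
    have : max (σu : ℝ) στ = 0 := le_antisymm (not_lt.1 hcon) (le_max_of_le_left σu.2)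
    rw [this, mul_zero, zero_pow two_ne_zero] at h2
    linarith
  have hLi : 0 < L⁻¹ := inv_pos.2 hL
  have h5 : trueValue L ν * L⁻¹ < L⁻¹ := by nlinarith
  have h6 : 0 ≤ trueValue L ν * L⁻¹ := by positivity
  gcongr

end Provider

section Feedback

variable {Ω : Type*} {m : MeasurableSpace Ω} {μ : Measure Ω} {ℱ : Filtration ℕ m} {K : ℕ}
  {ν : Fin K → Measure (ℝ × ℝ)} {u τ : Fin K → ℕ → Ω → ℝ} {σu στ : ℝ≥0} {L : ℝ}

lemma IsStationaryFeedback.measurable_pair (hf : IsStationaryFeedback μ ℱ ν u τ) (i : Fin K)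
    (t : ℕ) : Measurable[ℱ (t + 1)] (fun ω => (u i (t + 1) ω, τ i (t + 1) ω)) :=
  (hf.measurable_quality i t).prodMk (hf.measurable_latency i t)

lemma IsStationaryFeedback.isSubgaussianNoise (hf : IsStationaryFeedback μ ℱ ν u τ) (i : Fin K)
    {f : ℝ × ℝ → ℝ} (hfm : Measurable f) {c : ℝ≥0} (hsub : HasSubgaussianMGF f c (ν i)) :
    IsSubgaussianNoise μ ℱ (fun t ω => f (u i t ω, τ i t ω)) c where
  measurable t := hfm.comp (hf.measurable_pair i t)
  indep_past t := by
    refine indep_of_indep_of_le_left (hf.indep_past i t) ?_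
    rw [← measurable_iff_comap_le]
    exact hfm.comp (comap_measurable _)
  subgaussian t := by
    have hs : HasSubgaussianMGF f c (μ.map (fun ω => (u i (t + 1) ω, τ i (t + 1) ω))) := by
      rwa [hf.law i t]
    exact hs.of_map ((hf.measurable_pair i t).mono (ℱ.le _) le_rfl).aemeasurable

lemma IsStationaryFeedback.map_comp_eq (hf : IsStationaryFeedback μ ℱ ν u τ) (i : Fin K)
    {f : ℝ × ℝ → ℝ} (hfm : Measurable f) (t : ℕ) :
    μ.map (fun ω => f (u i (t + 1) ω, τ i (t + 1) ω)) = (ν i).map f := by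
  rw [← hf.law i t, Measure.map_map hfm ((hf.measurable_pair i t).mono (ℱ.le _) le_rfl)]
  rfl

lemma IsStationaryFeedback.ae_latency_nonneg (hf : IsStationaryFeedback μ ℱ ν u τ)
    (hν : ∀ i, IsProviderLaw (ν i) σu στ) : ∀ᵐ ω ∂μ, ∀ i, ∀ t, 1 ≤ t → 0 ≤ τ i t ω := by
  rw [ae_all_iff]
  intro i
  rw [ae_all_iff]
  intro t
  rcases t with _ | t
  · simp
  · have h := (hν i).latency_nonneg
    rw [← hf.law i t] at h
    filter_upwards [ae_of_ae_map
      ((hf.measurable_pair i t).mono (ℱ.le _) le_rfl).aemeasurable h] with ω hω _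
    exact hω

/-- The error of the plug-in estimator is at most the average of the linear noise. -/
lemma abs_plugIn_sub_trueValue_le {i : Fin K} (h : IsProviderLaw (ν i) σu στ) (hL : 0 < L)
    {S : Finset ℕ} (hS : S.Nonempty) {ω : Ω} (hτ : ∀ s ∈ S, 0 ≤ τ i s ω) :
    |plugIn L (u i) (τ i) S ω - trueValue L (ν i)|
      ≤ |∑ s ∈ S, linearNoise L (ν i) (u i s ω, τ i s ω)| / S.card := by
  have hn : (0 : ℝ) < S.card := by exact_mod_cast hS.card_pos
  have h1 := h.abs_renewalScore_sub_trueValue_le hL (empiricalMean (u i) S ω)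
    (τ := empiricalMean (τ i) S ω) (div_nonneg (Finset.sum_nonneg hτ) hn.le)
  refine h1.trans (le_of_eq ?_)
  have e : linearNoise L (ν i) (empiricalMean (u i) S ω, empiricalMean (τ i) S ω)
      = (∑ s ∈ S, linearNoise L (ν i) (u i s ω, τ i s ω)) / S.card := by
    simp only [linearNoise, empiricalMean, Finset.sum_sub_distrib, ← Finset.mul_sum,
      Finset.sum_const, nsmul_eq_mul]
    field_simp
  rw [e, abs_div, abs_of_pos hn]

/-- It suffices to control the summed linear noise. -/
lemma IsStationaryFeedback.one_sub_le_measureReal [IsProbabilityMeasure μ]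
    (hf : IsStationaryFeedback μ ℱ ν u τ) (hν : ∀ i, IsProviderLaw (ν i) σu στ) (hL : 0 < L)
    (i : Fin K) {S : Finset ℕ} (hS : S.Nonempty) (hS1 : ∀ s ∈ S, 1 ≤ s) {r δ : ℝ}
    (h : μ.real {ω | r * S.card < |∑ s ∈ S, linearNoise L (ν i) (u i s ω, τ i s ω)|} ≤ δ) :
    1 - δ ≤ μ.real {ω | |plugIn L (u i) (τ i) S ω - trueValue L (ν i)| ≤ r} := by
  have hn : (0 : ℝ) < S.card := by exact_mod_cast hS.card_pos
  have hu : μ.real ({ω | |plugIn L (u i) (τ i) S ω - trueValue L (ν i)| ≤ r} ∪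
      {ω | r * S.card < |∑ s ∈ S, linearNoise L (ν i) (u i s ω, τ i s ω)|}) = 1 := by
    rw [← probReal_univ (μ := μ)]
    refine measureReal_congr (eventuallyEq_univ.2 ?_)
    filter_upwards [hf.ae_latency_nonneg hν] with ω hω
    by_cases hr : r * S.card < |∑ s ∈ S, linearNoise L (ν i) (u i s ω, τ i s ω)|
    · exact Or.inr hr
    · refine Or.inl ((abs_plugIn_sub_trueValue_le (hν i) hL hS
        fun s hs => hω i s (hS1 s hs)).trans ?_)
      rw [div_le_iff₀ hn]
      exact not_lt.1 hr
  have := measureReal_union_le (μ := μ)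
    {ω | |plugIn L (u i) (τ i) S ω - trueValue L (ν i)| ≤ r}
    {ω | r * S.card < |∑ s ∈ S, linearNoise L (ν i) (u i s ω, τ i s ω)|}
  linarith

/-- Concentration of the plug-in estimator of the renewal value around a fixed set of rounds. -/
theorem IsStationaryFeedback.exists_concentration [IsProbabilityMeasure μ]
    (hf : IsStationaryFeedback μ ℱ ν u τ) (hν : ∀ i, IsProviderLaw (ν i) σu στ) (hL : 0 < L)
    (i : Fin K) :
    ∃ C : ℝ, ∀ S : Finset ℕ, S.Nonempty → (∀ s ∈ S, 1 ≤ s) →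
      ∀ δ : ℝ, 0 < δ → δ < 1 →
        1 - δ ≤ μ.real {ω | |plugIn L (u i) (τ i) S ω - trueValue L (ν i)| ≤
          (1 + L⁻¹) * √(2 * (max σu στ : ℝ) ^ 2 * Real.log (1 / δ) / (S.card : ℝ))
            + C / (S.card : ℝ)} := by
  have := (hν i).isProbability
  set M := (1 + L⁻¹) * max (σu : ℝ) στ with hM
  have hLi : 0 < L⁻¹ := inv_pos.2 hL
  have hσ0 : 0 ≤ max (σu : ℝ) στ := le_max_of_le_left σu.2
  have hM0 : 0 ≤ M := by positivity
  have hsub := (hν i).hasSubgaussianMGF_linearNoise hL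
  have hmf := measurable_linearNoise L (ν i)
  -- the level of the bound, multiplied by the number of rounds
  have hlevel {S : Finset ℕ} (hS : S.Nonempty) {δ C : ℝ} (hδ : 0 < δ) :
      ((1 + L⁻¹) * √(2 * (max σu στ : ℝ) ^ 2 * Real.log (1 / δ) / (S.card : ℝ))
        + C / (S.card : ℝ)) * S.card = M * √(2 * Real.log (1 / δ)) * √S.card + C := by
    have hn : (0 : ℝ) < S.card := by exact_mod_cast hS.card_pos
    have hsn : 0 < √(S.card : ℝ) := Real.sqrt_pos.2 hn
    have e1 : √(2 * (max σu στ : ℝ) ^ 2 * Real.log (1 / δ) / (S.card : ℝ))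
        = max (σu : ℝ) στ * √(2 * Real.log (1 / δ)) / √S.card := by
      rw [Real.sqrt_div' _ hn.le, mul_right_comm, Real.sqrt_mul' _ (sq_nonneg _),
        Real.sqrt_sq hσ0, mul_comm]
    rw [e1, add_mul, div_mul_cancel₀ _ hn.ne', hM]
    congr 1
    field_simp
    rw [Real.sq_sqrt hn.le]
  set V := ∫ p, linearNoise L (ν i) p ^ 2 ∂(ν i) with hV
  have hsq : Integrable (fun p => linearNoise L (ν i) p ^ 2) (ν i) := (hsub.memLp 2).integrable_sq
  have hV_nonneg : 0 ≤ V := integral_nonneg fun p => sq_nonneg _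
  rcases hV_nonneg.eq_or_lt with hV0 | hVpos
  · refine ⟨0, fun S hS hS1 δ hδ hδ1 => hf.one_sub_le_measureReal hν hL i hS hS1 ?_⟩
    rw [hlevel hS hδ, add_zero]
    have hz : ∀ᵐ p ∂(ν i), linearNoise L (ν i) p = 0 := by
      have := (integral_eq_zero_iff_of_nonneg_ae
        (ae_of_all _ fun p => sq_nonneg (linearNoise L (ν i) p)) hsq).1 hV0.symm
      filter_upwards [this] with p hp
      simpa using hp
    have hz2 : ∀ᵐ ω ∂μ, ∀ t, 1 ≤ t → linearNoise L (ν i) (u i t ω, τ i t ω) = 0 := by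
      rw [ae_all_iff]
      intro t
      rcases t with _ | t
      · simp
      · have hz' : ∀ᵐ p ∂(μ.map (fun ω => (u i (t + 1) ω, τ i (t + 1) ω))),
            linearNoise L (ν i) p = 0 := by rwa [hf.law i t]
        filter_upwards [ae_of_ae_map
          ((hf.measurable_pair i t).mono (ℱ.le _) le_rfl).aemeasurable hz'] with ω hω _
        exact hω
    have hnull : μ.real {ω | M * √(2 * Real.log (1 / δ)) * √S.card
        < |∑ s ∈ S, linearNoise L (ν i) (u i s ω, τ i s ω)|} = 0 := by
      rw [measureReal_eq_zero_iff]
      refine measure_eq_zero_iff_ae_notMem.2 ?_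
      filter_upwards [hz2] with ω hω hω2
      rw [Finset.sum_eq_zero fun s hs => hω s (hS1 s hs), abs_zero] at hω2
      exact absurd hω2 (not_lt.2 (by positivity))
    rw [hnull]
    exact hδ.le
  · -- standardize the noise
    set d := √V with hd
    have hdpos : 0 < d := Real.sqrt_pos.2 hVpos
    have hd2 : d ^ 2 = V := Real.sq_sqrt hVpos.le
    set f : ℝ × ℝ → ℝ := fun p => d⁻¹ * linearNoise L (ν i) p with hfdef
    have hfm : Measurable f := hmf.const_mul _
    have hfsub := hsub.const_mul d⁻¹
    set c : ℝ≥0 := ⟨d⁻¹ ^ 2, sq_nonneg _⟩ * (σu + (trueValue L (ν i) / L).toNNReal * στ) ^ 2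
      with hc
    have hfsq : ∫ p, f p ^ 2 ∂(ν i) = 1 := by
      simp_rw [hfdef, mul_pow]
      rw [integral_const_mul, ← hV, ← hd2, inv_pow, inv_mul_cancel₀ (by positivity)]
    have hf0 : ∫ p, f p ∂(ν i) = 0 := by
      have e : ∫ p, linearNoise L (ν i) p ∂(ν i) = 0 := by
        have i1 := (hν i).quality_subgaussian.integrable
        have i2 := (hν i).latency_subgaussian.integrable
        simp only [linearNoise]
        rw [integral_sub i1 (i2.const_mul _), integral_const_mul,
          integral_sub (hν i).integrable_quality (integrable_const _),
          integral_sub (hν i).integrable_latency (integrable_const _)]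
        simp
      rw [hfdef, integral_const_mul, e, mul_zero]
    have hc1 : (1 : ℝ) ≤ c := by
      rw [← hfsq]; exact integral_sq_le_of_hasSubgaussianMGF hfsub
    have hcM : (c : ℝ) < (M / d) ^ 2 := by
      have h1 := (hν i).noiseProxy_lt hL hVpos
      have e : (c : ℝ) = d⁻¹ ^ 2 *
          (((σu + (trueValue L (ν i) / L).toNNReal * στ) ^ 2 : ℝ≥0) : ℝ) := rfl
      rw [e, inv_pow, div_pow, div_eq_inv_mul (M ^ 2)]
      exact mul_lt_mul_of_pos_left h1 (by positivity)
    have : IsProbabilityMeasure ((ν i).map f) := Measure.isProbabilityMeasure_map hfm.aemeasurable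
    obtain ⟨C, hC⟩ := exists_forall_tail_le ((ν i).map f)
      (by rw [integral_map hfm.aemeasurable (by fun_prop)]; exact hf0)
      (by rw [integral_map hfm.aemeasurable (by fun_prop)]; exact hfsq)
      hc1 (div_nonneg hM0 hdpos.le) hcM
    refine ⟨d * C, fun S hS hS1 δ hδ hδ1 => hf.one_sub_le_measureReal hν hL i hS hS1 ?_⟩
    rw [hlevel hS hδ]
    have hnoise := hf.isSubgaussianNoise i hfm hfsub
    have hsm : Measurable (fun ω => ∑ s ∈ S, f (u i s ω, τ i s ω)) := by
      refine Finset.measurable_fun_sum _ fun s hs => ?_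
      have := hS1 s hs
      obtain ⟨q, rfl⟩ : ∃ q, s = q + 1 := ⟨s - 1, by omega⟩
      exact (hnoise.measurable q).mono (ℱ.le _) le_rfl
    set x := √(2 * Real.log (1 / δ)) with hx
    have hlog : 0 < Real.log (1 / δ) := Real.log_pos (one_lt_one_div hδ hδ1)
    have hxpos : 0 < x := Real.sqrt_pos.2 (by positivity)
    have hxδ : Real.exp (-x ^ 2 / 2) = δ := by
      rw [hx, Real.sq_sqrt (by positivity), one_div, Real.log_inv]
      rw [show -(2 * -Real.log δ) / 2 = Real.log δ by ring, Real.exp_log hδ]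
    have htail : ∀ a : ℝ, 0 ≤ a →
        (μ.map (fun ω => ∑ s ∈ S, f (u i s ω, τ i s ω))).real {y | a < |y|}
          ≤ 2 * Real.exp (-a ^ 2 / (2 * (S.card * c))) := by
      intro a ha
      rw [map_measureReal_apply hsm (measurableSet_lt (by fun_prop) (by fun_prop))]
      have hpos : 0 < c := by
        have : (0 : ℝ) < c := by linarith
        exact_mod_cast this
      have h1 := hnoise.measureReal_lt_abs_sum_le hpos (fun t _ => t ∈ S)
        (fun t => MeasurableSet.const _) (S.sup id) (Finset.card_pos.2 hS) ha
      have e : Finset.filter (fun t => t ∈ S) (Finset.Ico 1 (S.sup id + 1)) = S := by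
        ext s
        simp only [Finset.mem_filter, Finset.mem_Ico, and_iff_right_iff_imp]
        exact fun hs => ⟨hS1 s hs, Nat.lt_succ_of_le (Finset.le_sup (f := id) hs)⟩
      rw [e] at h1
      simpa using h1
    have hmain := hC S.card (Finset.card_pos.2 hS)
      (μ.map (fun ω => ∑ s ∈ S, f (u i s ω, τ i s ω)))
      (Measure.isProbabilityMeasure_map hsm.aemeasurable)
      (hnoise.charFun_map_sum (hf.map_comp_eq i hfm) S hS1) htail x hxpos
    rw [map_measureReal_apply hsm (measurableSet_lt (by fun_prop) (by fun_prop)), hxδ] at hmain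
    refine le_trans (measureReal_mono fun ω hω => ?_) hmain
    simp only [mem_ofPred_eq, mem_preimage, hfdef] at hω ⊢
    rw [← Finset.mul_sum, abs_mul, abs_of_pos (inv_pos.2 hdpos), lt_inv_mul_iff₀ hdpos]
    refine lt_of_eq_of_lt ?_ hω
    field_simp

end Feedback

/-! ### Regret of the optimistic router -/

section Regret

variable {Ω : Type*} {m : MeasurableSpace Ω} {μ : Measure Ω} {ℱ : Filtration ℕ m} {K : ℕ}
  {ν : Fin K → Measure (ℝ × ℝ)} {u τ : Fin K → ℕ → Ω → ℝ} {I : ℕ → Ω → Fin K}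
  {σu στ : ℝ≥0} {L β : ℝ}

/-- The exploration bonus of provider `i` at round `t`. -/
noncomputable def bonus (β : ℝ) (I : ℕ → Ω → Fin K) (i : Fin K) (t : ℕ) (ω : Ω) : ℝ :=
  β * √(Real.log t / ((calls I i t ω).card + 1))

/-- The event that provider `i` has been called before round `t` and its average linear noise
exceeds its exploration bonus. -/
def deviationEvent (L β : ℝ) (ν : Fin K → Measure (ℝ × ℝ)) (u τ : Fin K → ℕ → Ω → ℝ)
    (I : ℕ → Ω → Fin K) (i : Fin K) (t : ℕ) : Set Ω :=
  {ω | (calls I i t ω).Nonempty ∧ bonus β I i t ω * (calls I i t ω).card <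
    |∑ s ∈ calls I i t ω, linearNoise L (ν i) (u i s ω, τ i s ω)|}

lemma IsProviderLaw.hasSubgaussianMGF_linearNoise_max {ν : Measure (ℝ × ℝ)}
    (h : IsProviderLaw ν σu στ) (hL : 0 < L) :
    HasSubgaussianMGF (linearNoise L ν) (((1 + L⁻¹).toNNReal * max σu στ) ^ 2) ν where
  integrable_exp_mul := (h.hasSubgaussianMGF_linearNoise hL).integrable_exp_mul
  mgf_le t := by
    refine ((h.hasSubgaussianMGF_linearNoise hL).mgf_le t).trans (Real.exp_le_exp.2 ?_)
    have hLi : 0 < L⁻¹ := inv_pos.2 hL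
    have h1 := sq_noiseProxy_le (h.trueValue_nonneg hL) hL σu στ
    have hσ0 : 0 ≤ max (σu : ℝ) στ := le_max_of_le_left σu.2
    have h2 : ((1 + trueValue L ν * L⁻¹) * max (σu : ℝ) στ) ^ 2
        ≤ ((1 + L⁻¹) * max (σu : ℝ) στ) ^ 2 := by
      have := h.trueValue_nonneg hL
      have : trueValue L ν * L⁻¹ ≤ 1 * L⁻¹ := by
        gcongr; exact h.trueValue_le_one hL
      gcongr
      linarith
    have e : ((((1 + L⁻¹).toNNReal * max σu στ) ^ 2 : ℝ≥0) : ℝ)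
        = ((1 + L⁻¹) * max (σu : ℝ) στ) ^ 2 := by
      push_cast
      rw [Real.coe_toNNReal _ (by positivity)]
    rw [e]
    gcongr
    exact h1.trans h2

/-- The union bound over the number of calls: with exploration coefficient at least `4` times the
sub-Gaussian scale, the deviation event has summable probability. -/
lemma IsStationaryFeedback.measureReal_deviationEvent_le [IsProbabilityMeasure μ]
    (hf : IsStationaryFeedback μ ℱ ν u τ) (hν : ∀ i, IsProviderLaw (ν i) σu στ) (hL : 0 < L)
    (hσ : 0 < max σu στ) (hI : ∀ t, Measurable[ℱ t] (I (t + 1))) {b : ℝ} (hb : 4 ≤ b)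
    (i : Fin K) {t : ℕ} (ht : 1 ≤ t) :
    μ.real (deviationEvent L (b * (1 + L⁻¹) * max (σu : ℝ) στ) ν u τ I i t) ≤ 2 / (t : ℝ) ^ 2 := by
  obtain ⟨q, rfl⟩ : ∃ q, t = q + 1 := ⟨t - 1, by omega⟩
  have hLi : 0 < L⁻¹ := inv_pos.2 hL
  set σ : ℝ := max (σu : ℝ) στ with hσdef
  have hσpos : 0 < σ := by rw [hσdef, ← NNReal.coe_max]; exact_mod_cast hσ
  set M := (1 + L⁻¹) * σ with hM
  have hMpos : 0 < M := by positivity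
  set c : ℝ≥0 := ((1 + L⁻¹).toNNReal * max σu στ) ^ 2 with hc
  have hcM : (c : ℝ) = M ^ 2 := by
    rw [hc]; push_cast; rw [Real.coe_toNNReal _ (by positivity)]
  have hcpos : 0 < c := by
    have : (0 : ℝ) < c := by rw [hcM]; positivity
    exact_mod_cast this
  have hnoise := hf.isSubgaussianNoise i (measurable_linearNoise L (ν i))
    ((hν i).hasSubgaussianMGF_linearNoise_max hL)
  set l := Real.log ((q + 1 : ℕ) : ℝ) with hl
  have hl0 : 0 ≤ l := Real.log_natCast_nonneg _
  let E (n : ℕ) : Set Ω := {ω | (calls I i (q + 1) ω).card = n ∧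
    b * M * √(l / (n + 1)) * n < |∑ s ∈ calls I i (q + 1) ω,
      linearNoise L (ν i) (u i s ω, τ i s ω)|}
  have hsub : deviationEvent L (b * (1 + L⁻¹) * σ) ν u τ I i (q + 1)
      ⊆ ⋃ n ∈ Finset.Ico 1 (q + 1), E n := by
    rintro ω ⟨hω1, hω2⟩
    refine mem_iUnion₂.2 ⟨(calls I i (q + 1) ω).card, ?_, rfl, ?_⟩
    · rw [Finset.mem_Ico]
      refine ⟨Finset.card_pos.2 hω1, Nat.lt_succ_of_le ?_⟩
      refine (Finset.card_filter_le _ _).trans ?_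
      simp
    · rwa [bonus, mul_assoc b] at hω2
  have hE (n : ℕ) (hn : n ∈ Finset.Ico 1 (q + 1)) :
      μ.real (E n) ≤ 2 * (((q + 1 : ℕ) : ℝ) ^ 3)⁻¹ := by
    have hn1 : 1 ≤ n := (Finset.mem_Ico.1 hn).1
    have hnR : (1 : ℝ) ≤ n := by exact_mod_cast hn1
    refine (hnoise.measureReal_lt_abs_sum_le hcpos (fun s ω => I s ω = i)
      (fun s => (hI s) (measurableSet_singleton i)) q hn1
      (a := b * M * √(l / (n + 1)) * n) (by positivity)).trans ?_
    have e1 : (((q + 1 : ℕ) : ℝ) ^ 3)⁻¹ = Real.exp (-(3 * l)) := by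
      rw [Real.exp_neg, mul_comm, Real.exp_mul, hl, Real.exp_log (by positivity)]
      norm_cast
    rw [e1]
    gcongr
    rw [hcM, mul_pow, mul_pow, mul_pow, Real.sq_sqrt (by positivity), neg_div, neg_le_neg_iff]
    have e2 : b ^ 2 * M ^ 2 * (l / (n + 1)) * (n : ℝ) ^ 2 / (2 * (n * M ^ 2))
        = b ^ 2 * (n / (2 * (n + 1))) * l := by
      field_simp
    rw [e2]
    have h3 : (1 : ℝ) / 4 ≤ n / (2 * (n + 1)) := by
      rw [div_le_div_iff₀ (by norm_num) (by positivity)]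
      linarith
    have h4 : (3 : ℝ) ≤ b ^ 2 * (n / (2 * (n + 1))) := by nlinarith
    gcongr
  calc μ.real (deviationEvent L (b * (1 + L⁻¹) * σ) ν u τ I i (q + 1))
      ≤ μ.real (⋃ n ∈ Finset.Ico 1 (q + 1), E n) := measureReal_mono hsub (measure_ne_top _ _)
    _ ≤ ∑ n ∈ Finset.Ico 1 (q + 1), μ.real (E n) := measureReal_biUnion_finset_le _ _
    _ ≤ ∑ n ∈ Finset.Ico 1 (q + 1), 2 * (((q + 1 : ℕ) : ℝ) ^ 3)⁻¹ := Finset.sum_le_sum hE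
    _ = q * (2 * (((q + 1 : ℕ) : ℝ) ^ 3)⁻¹) := by simp
    _ ≤ ((q + 1 : ℕ) : ℝ) * (2 * (((q + 1 : ℕ) : ℝ) ^ 3)⁻¹) := by gcongr; simp
    _ = 2 / ((q + 1 : ℕ) : ℝ) ^ 2 := by field_simp

/-- Outside the deviation events, a suboptimal provider is called again only if its bonus is at
least half its gap. -/
lemma IsScoreRouter.card_calls_add_one_le (hr : IsScoreRouter ℱ L β 0 u τ I)
    (hν : ∀ i, IsProviderLaw (ν i) σu στ) (hL : 0 < L) {j : Fin K}
    (hj : trueValue L (ν j) = ⨆ k, trueValue L (ν k)) {t : ℕ} (ht : 1 ≤ t) {ω : Ω}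
    (hτ : ∀ i, ∀ s, 1 ≤ s → 0 ≤ τ i s ω) (hgap : 0 < valueGap L ν (I t ω))
    (hexp : 1 ≤ β * √(Real.log t)) (hne : (calls I (I t ω) t ω).Nonempty)
    (hbi : ω ∉ deviationEvent L β ν u τ I (I t ω) t)
    (hbj : ω ∉ deviationEvent L β ν u τ I j t) :
    ((calls I (I t ω) t ω).card : ℝ) + 1 ≤
      4 * β ^ 2 * Real.log t / valueGap L ν (I t ω) ^ 2 := by
  set i := I t ω with hi
  have hpos (k : Fin K) (hk : (calls I k t ω).Nonempty)
      (hb : ω ∉ deviationEvent L β ν u τ I k t) :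
      |plugIn L (u k) (τ k) (calls I k t ω) ω - trueValue L (ν k)| ≤ bonus β I k t ω := by
    have hn : (0 : ℝ) < (calls I k t ω).card := by exact_mod_cast hk.card_pos
    refine (abs_plugIn_sub_trueValue_le (hν k) hL hk fun s hs =>
      hτ k s (Finset.mem_Ico.1 (Finset.mem_of_mem_filter s hs)).1).trans ?_
    rw [div_le_iff₀ hn]
    by_contra hcon
    exact hb ⟨hk, not_le.1 hcon⟩
  have hscore (k : Fin K) : selectionScore L β 0 u τ I k t ω
      = plugIn L (u k) (τ k) (calls I k t ω) ω + bonus β I k t ω := by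
    simp [selectionScore, bonus]
  have hmax := hr.maximal t ht ω j
  rw [hscore, hscore, ← hi] at hmax
  have hjle : trueValue L (ν j) ≤ plugIn L (u j) (τ j) (calls I j t ω) ω + bonus β I j t ω := by
    -- before its first call a provider has estimate `0`, and `hexp` makes the bonus alone suffice
    rcases (calls I j t ω).eq_empty_or_nonempty with h0 | h1
    · have e : plugIn L (u j) (τ j) (calls I j t ω) ω = 0 := by
        simp [h0, plugIn, renewalScore, empiricalMean]
      have e2 : bonus β I j t ω = β * √(Real.log t) := by simp [bonus, h0]
      rw [e, e2, zero_add]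
      exact ((hν j).trueValue_le_one hL).trans hexp
    · linarith [(abs_le.1 (hpos j h1 hbj)).1]
  have hile := (abs_le.1 (hpos i hne hbi)).2
  have hΔ : valueGap L ν i = trueValue L (ν j) - trueValue L (ν i) := by rw [valueGap, hj]
  have hle : valueGap L ν i ≤ 2 * bonus β I i t ω := by rw [hΔ]; linarith
  have hl0 : 0 ≤ Real.log (t : ℝ) := Real.log_natCast_nonneg _
  have hsq : valueGap L ν i ^ 2 ≤ (2 * bonus β I i t ω) ^ 2 := by gcongr
  rw [bonus, mul_pow, mul_pow, Real.sq_sqrt (by positivity)] at hsq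
  rw [le_div_iff₀ (by positivity)]
  have hN : (0 : ℝ) < ((calls I i t ω).card : ℝ) + 1 := by positivity
  calc (((calls I i t ω).card : ℝ) + 1) * valueGap L ν i ^ 2
      ≤ (((calls I i t ω).card : ℝ) + 1)
        * (2 ^ 2 * (β ^ 2 * (Real.log t / ((calls I i t ω).card + 1)))) := by gcongr
    _ = 4 * β ^ 2 * Real.log t := by field_simp; ring

/-- A provider is called at most `n + 1` times while it has at most `n` previous calls. -/
lemma card_filter_card_calls_le (I : ℕ → Ω → Fin K) (i : Fin K) (T n : ℕ) (ω : Ω) :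
    (Finset.filter (fun t => I t ω = i ∧ (calls I i t ω).card ≤ n) (Finset.Icc 1 T)).card
      ≤ n + 1 := by
  rw [← Finset.card_range (n + 1)]
  refine Finset.card_le_card_of_injOn (fun t => (calls I i t ω).card) ?_ ?_
  · intro t ht
    have := (Finset.mem_filter.1 ht).2.2
    simp only [Finset.coe_range, mem_Iio]
    omega
  · have hlt : ∀ s t : ℕ, 1 ≤ s → s < t → I s ω = i →
        (calls I i s ω).card < (calls I i t ω).card := by
      intro s t hs hst hsi
      refine Finset.card_lt_card (Finset.ssubset_iff_of_subset ?_ |>.2 ⟨s, ?_, ?_⟩)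
      · exact Finset.filter_subset_filter _ (Finset.Ico_subset_Ico_right hst.le)
      · exact Finset.mem_filter.2 ⟨Finset.mem_Ico.2 ⟨hs, hst⟩, hsi⟩
      · simp [calls]
    intro s hs t ht hst
    have hs' := Finset.mem_filter.1 hs
    have ht' := Finset.mem_filter.1 ht
    have hs1 := (Finset.mem_Icc.1 hs'.1).1
    have ht1 := (Finset.mem_Icc.1 ht'.1).1
    rcases lt_trichotomy s t with h | h | h
    · exact absurd hst (hlt s t hs1 h hs'.2.1).ne
    · exact h
    · exact absurd hst (hlt t s ht1 h ht'.2.1).ne'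

lemma valueGap_nonneg (L : ℝ) (ν : Fin K → Measure (ℝ × ℝ)) (i : Fin K) : 0 ≤ valueGap L ν i :=
  sub_nonneg.2 (le_ciSup (f := fun j => trueValue L (ν j)) (Set.finite_range _).bddAbove i)

/-- Pathwise bound on the number of calls of a suboptimal provider. -/
lemma IsScoreRouter.card_filter_eq_le (hr : IsScoreRouter ℱ L β 0 u τ I)
    (hν : ∀ i, IsProviderLaw (ν i) σu στ) (hL : 0 < L) {j : Fin K}
    (hj : trueValue L (ν j) = ⨆ k, trueValue L (ν k)) {t₀ : ℕ}
    (ht₀ : ∀ t : ℕ, t₀ ≤ t → 1 ≤ β * √(Real.log t)) {ω : Ω}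
    (hτ : ∀ i, ∀ s, 1 ≤ s → 0 ≤ τ i s ω) {i : Fin K} (hgap : 0 < valueGap L ν i) (T : ℕ) :
    ((Finset.filter (fun t => I t ω = i) (Finset.Icc 1 T)).card : ℝ) ≤
      (4 * β ^ 2 * Real.log T / valueGap L ν i ^ 2 + 1 + t₀) +
        ∑ t ∈ Finset.Icc 1 T,
          ((deviationEvent L β ν u τ I i t).indicator (fun _ => (1 : ℝ)) ω
            + (deviationEvent L β ν u τ I j t).indicator (fun _ => (1 : ℝ)) ω) := by
  classical
  -- a call at round `t` is early, or follows at most `Q` calls, or lies in a deviation event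
  set Q := 4 * β ^ 2 * Real.log T / valueGap L ν i ^ 2 with hQ
  have hQ0 : 0 ≤ Q := by
    have := Real.log_natCast_nonneg T
    positivity
  set A := Finset.filter (fun t => I t ω = i ∧ (calls I i t ω).card ≤ ⌊Q⌋₊) (Finset.Icc 1 T)
  set Bi := Finset.filter (fun t => ω ∈ deviationEvent L β ν u τ I i t) (Finset.Icc 1 T)
  set Bj := Finset.filter (fun t => ω ∈ deviationEvent L β ν u τ I j t) (Finset.Icc 1 T)
  have hsub : Finset.filter (fun t => I t ω = i) (Finset.Icc 1 T)
      ⊆ (A ∪ Finset.range t₀) ∪ (Bi ∪ Bj) := by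
    intro t ht
    obtain ⟨htT, hti⟩ := Finset.mem_filter.1 ht
    obtain ⟨ht1, htT'⟩ := Finset.mem_Icc.1 htT
    simp only [Finset.mem_union, Finset.mem_range]
    by_cases h1 : t < t₀
    · exact Or.inl (Or.inr h1)
    by_cases h2 : ω ∈ deviationEvent L β ν u τ I i t
    · exact Or.inr (Or.inl (Finset.mem_filter.2 ⟨htT, h2⟩))
    by_cases h3 : ω ∈ deviationEvent L β ν u τ I j t
    · exact Or.inr (Or.inr (Finset.mem_filter.2 ⟨htT, h3⟩))
    refine Or.inl (Or.inl (Finset.mem_filter.2 ⟨htT, hti, ?_⟩))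
    rcases (calls I i t ω).eq_empty_or_nonempty with h0 | hne
    · simp [h0]
    subst hti
    have h4 := hr.card_calls_add_one_le hν hL hj ht1 hτ hgap (ht₀ t (not_lt.1 h1)) hne h2 h3
    refine Nat.le_floor ?_
    have hlog : Real.log (t : ℝ) ≤ Real.log T :=
      Real.log_le_log (by exact_mod_cast ht1) (by exact_mod_cast htT')
    have h5 : 4 * β ^ 2 * Real.log t / valueGap L ν (I t ω) ^ 2 ≤ Q := by rw [hQ]; gcongr
    linarith
  have hcard : (Finset.filter (fun t => I t ω = i) (Finset.Icc 1 T)).card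
      ≤ (⌊Q⌋₊ + 1) + t₀ + (Bi.card + Bj.card) := by
    refine (Finset.card_le_card hsub).trans ((Finset.card_union_le _ _).trans ?_)
    refine add_le_add ((Finset.card_union_le _ _).trans (add_le_add ?_ ?_))
      (Finset.card_union_le _ _)
    · exact card_filter_card_calls_le I i T _ ω
    · simp
  have hind (k : Fin K) : ∑ t ∈ Finset.Icc 1 T,
      (deviationEvent L β ν u τ I k t).indicator (fun _ => (1 : ℝ)) ω
      = (Finset.filter (fun t => ω ∈ deviationEvent L β ν u τ I k t) (Finset.Icc 1 T)).card := by
    simp only [indicator_apply]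
    rw [Finset.sum_boole]
  rw [Finset.sum_add_distrib, hind, hind]
  have hcardR : ((Finset.filter (fun t => I t ω = i) (Finset.Icc 1 T)).card : ℝ)
      ≤ ((⌊Q⌋₊ : ℝ) + 1) + t₀ + (Bi.card + Bj.card) := by exact_mod_cast hcard
  linarith [Nat.floor_le hQ0]

/-- The regret as a sum over providers of gap times number of calls. -/
lemma sum_valueGap_eq (L : ℝ) (ν : Fin K → Measure (ℝ × ℝ)) (I : ℕ → Ω → Fin K) (T : ℕ) (ω : Ω) :
    ∑ t ∈ Finset.Icc 1 T, valueGap L ν (I t ω) =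
      ∑ i with 0 < valueGap L ν i,
        valueGap L ν i * (Finset.filter (fun t => I t ω = i) (Finset.Icc 1 T)).card := by
  have h1 : ∑ t ∈ Finset.Icc 1 T, valueGap L ν (I t ω) =
      ∑ i, valueGap L ν i * (Finset.filter (fun t => I t ω = i) (Finset.Icc 1 T)).card := by
    rw [← Finset.sum_fiberwise (Finset.Icc 1 T) (fun t => I t ω)]
    refine Finset.sum_congr rfl fun i _ => ?_
    rw [Finset.sum_congr rfl (g := fun _ => valueGap L ν i)
      fun t ht => by rw [(Finset.mem_filter.1 ht).2], Finset.sum_const, nsmul_eq_mul, mul_comm]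
  rw [h1, Finset.sum_filter]
  refine Finset.sum_congr rfl fun i _ => ?_
  split_ifs with h
  · rfl
  · rw [le_antisymm (not_lt.1 h) (valueGap_nonneg L ν i), zero_mul]

/-- Logarithmic regret of the optimistic router. -/
theorem IsScoreRouter.regret_le [IsProbabilityMeasure μ]
    (hf : IsStationaryFeedback μ ℱ ν u τ) (hν : ∀ i, IsProviderLaw (ν i) σu στ) (hL : 0 < L)
    (hσ : 0 < max σu στ) {b : ℝ} (hb : 4 ≤ b)
    (hr : IsScoreRouter ℱ L (b * (1 + L⁻¹) * max (σu : ℝ) στ) 0 u τ I) :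
    ∃ G : ℝ, ∀ T : ℕ, regret L ν μ I T ≤
      (∑ i with 0 < valueGap L ν i,
        4 * b ^ 2 * (1 + L⁻¹) ^ 2 * max (σu : ℝ) στ ^ 2 * Real.log T / valueGap L ν i) + G := by
  have hLi : 0 < L⁻¹ := inv_pos.2 hL
  have hσpos : 0 < max (σu : ℝ) στ := by rw [← NNReal.coe_max]; exact_mod_cast hσ
  set β := b * (1 + L⁻¹) * max (σu : ℝ) στ with hβ
  have hβpos : 0 < β := by
    have : 0 < b := by linarith
    positivity
  have hne : Nonempty Ω := μ.nonempty_of_neZero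
  have hneK : Nonempty (Fin K) := hne.map (I 0)
  obtain ⟨j, hj⟩ := exists_eq_ciSup_of_finite (f := fun k => trueValue L (ν k))
  obtain ⟨t₀, ht₀⟩ : ∃ t₀ : ℕ, ∀ t : ℕ, t₀ ≤ t → 1 ≤ β * √(Real.log t) := by
    have h1 : Tendsto (fun t : ℕ => β * √(Real.log (t : ℝ))) atTop atTop :=
      (Real.tendsto_sqrt_atTop.comp
        (Real.tendsto_log_atTop.comp tendsto_natCast_atTop_atTop)).const_mul_atTop hβpos
    exact eventually_atTop.1 (h1.eventually_ge_atTop 1)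
  have hsum : Summable fun t : ℕ => 2 / (t : ℝ) ^ 2 := by
    simpa [div_eq_mul_inv] using (Real.summable_one_div_nat_pow.2 one_lt_two).mul_left 2
  set D := ∑' t : ℕ, 2 / (t : ℝ) ^ 2 with hD
  refine ⟨∑ i with 0 < valueGap L ν i, valueGap L ν i * (1 + t₀ + 2 * D), fun T => ?_⟩
  -- measurable hulls, so that the indicators can be integrated
  let B (k : Fin K) (t : ℕ) : Set Ω := toMeasurable μ (deviationEvent L β ν u τ I k t)
  have hBm (k : Fin K) (t : ℕ) : MeasurableSet (B k t) := measurableSet_toMeasurable _ _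
  have hBsum (k : Fin K) : ∑ t ∈ Finset.Icc 1 T, μ.real (B k t) ≤ D := by
    refine (Finset.sum_le_sum fun t ht => ?_).trans
      (hsum.sum_le_tsum (Finset.Icc 1 T) fun t _ => by positivity)
    rw [Measure.real, measure_toMeasurable]
    exact hf.measureReal_deviationEvent_le hν hL hσ hr.predictable hb k (Finset.mem_Icc.1 ht).1
  let H (i : Fin K) (ω : Ω) : ℝ := (4 * β ^ 2 * Real.log T / valueGap L ν i ^ 2 + 1 + t₀) +
    ∑ t ∈ Finset.Icc 1 T, ((B i t).indicator (fun _ => (1 : ℝ)) ω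
      + (B j t).indicator (fun _ => (1 : ℝ)) ω)
  have hindi (k : Fin K) (t : ℕ) : Integrable ((B k t).indicator (fun _ => (1 : ℝ))) μ :=
    (integrable_const 1).indicator (hBm k t)
  have hpair (i : Fin K) (t : ℕ) : Integrable (fun ω => (B i t).indicator (fun _ => (1 : ℝ)) ω
      + (B j t).indicator (fun _ => (1 : ℝ)) ω) μ := (hindi i t).add (hindi j t)
  have hsumi (i : Fin K) : Integrable (fun ω => ∑ t ∈ Finset.Icc 1 T,
      ((B i t).indicator (fun _ => (1 : ℝ)) ω + (B j t).indicator (fun _ => (1 : ℝ)) ω)) μ :=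
    integrable_finsetSum _ fun t _ => hpair i t
  have hHi (i : Fin K) : Integrable (H i) μ := (integrable_const _).add (hsumi i)
  have hHint (i : Fin K) :
      ∫ ω, H i ω ∂μ ≤ (4 * β ^ 2 * Real.log T / valueGap L ν i ^ 2 + 1 + t₀) + 2 * D := by
    simp only [H]
    rw [integral_add (integrable_const _) (hsumi i),
      integral_finsetSum _ fun t _ => hpair i t]
    have e (t : ℕ) : ∫ ω, ((B i t).indicator (fun _ => (1 : ℝ)) ω
        + (B j t).indicator (fun _ => (1 : ℝ)) ω) ∂μ = μ.real (B i t) + μ.real (B j t) := by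
      rw [integral_add (hindi i t) (hindi j t), integral_indicator_const _ (hBm i t),
        integral_indicator_const _ (hBm j t)]
      simp
    simp_rw [e]
    rw [Finset.sum_add_distrib]
    simp only [integral_const, probReal_univ, smul_eq_mul, one_mul]
    linarith [hBsum i, hBsum j]
  have hpath : ∀ᵐ ω ∂μ, ∑ t ∈ Finset.Icc 1 T, valueGap L ν (I t ω)
      ≤ ∑ i with 0 < valueGap L ν i, valueGap L ν i * H i ω := by
    filter_upwards [hf.ae_latency_nonneg hν] with ω hω
    rw [sum_valueGap_eq]
    refine Finset.sum_le_sum fun i hi => ?_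
    have hgap := (Finset.mem_filter.1 hi).2
    refine mul_le_mul_of_nonneg_left
      ((hr.card_filter_eq_le hν hL hj ht₀ hω hgap T).trans ?_) hgap.le
    simp only [H]
    have hmono (k : Fin K) (t : ℕ) :
        (deviationEvent L β ν u τ I k t).indicator (fun _ => (1 : ℝ)) ω
          ≤ (B k t).indicator (fun _ => (1 : ℝ)) ω :=
      indicator_le_indicator_of_subset (subset_toMeasurable _ _) (fun _ => zero_le_one) ω
    exact add_le_add_right (Finset.sum_le_sum fun t _ => add_le_add (hmono i t) (hmono j t)) _
  have hint : Integrable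
      (fun ω => ∑ i with 0 < valueGap L ν i, valueGap L ν i * H i ω) μ :=
    integrable_finsetSum _ fun i _ => (hHi i).const_mul _
  calc regret L ν μ I T
      ≤ ∫ ω, ∑ i with 0 < valueGap L ν i, valueGap L ν i * H i ω ∂μ :=
        integral_mono_of_nonneg
          (ae_of_all _ fun ω => Finset.sum_nonneg fun t _ => valueGap_nonneg L ν _) hint hpath
    _ = ∑ i with 0 < valueGap L ν i, valueGap L ν i * ∫ ω, H i ω ∂μ := by
        rw [integral_finsetSum _ fun i _ => (hHi i).const_mul _]
        simp_rw [integral_const_mul]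
    _ ≤ ∑ i with 0 < valueGap L ν i, (4 * b ^ 2 * (1 + L⁻¹) ^ 2 * max (σu : ℝ) στ ^ 2
          * Real.log T / valueGap L ν i + valueGap L ν i * (1 + t₀ + 2 * D)) := by
        refine Finset.sum_le_sum fun i hi => ?_
        have hgap := (Finset.mem_filter.1 hi).2
        refine (mul_le_mul_of_nonneg_left (hHint i) hgap.le).trans (le_of_eq ?_)
        rw [hβ]
        field_simp
        ring
    _ = _ := Finset.sum_add_distrib

end Regret

end RenewalRouting

open RenewalRouting in
theorem mainTheorem3 :
    (∀ (Ω : Type*) (m : MeasurableSpace Ω) (μ : Measure Ω) (_ : IsProbabilityMeasure μ)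
        (ℱ : Filtration ℕ m) (K : ℕ) (ν : Fin K → Measure (ℝ × ℝ)) (u τ : Fin K → ℕ → Ω → ℝ)
        (L : ℝ) (σu στ : ℝ≥0),
      0 < L → (∀ i, IsProviderLaw (ν i) σu στ) → IsStationaryFeedback μ ℱ ν u τ →
      ∀ i, ∃ C : ℝ, ∀ S : Finset ℕ, S.Nonempty → (∀ s ∈ S, 1 ≤ s) →
        ∀ δ : ℝ, 0 < δ → δ < 1 →
          1 - δ ≤ μ.real {ω | |plugIn L (u i) (τ i) S ω - trueValue L (ν i)| ≤
            (1 + L⁻¹) * √(2 * (max σu στ : ℝ) ^ 2 * Real.log (1 / δ) / (S.card : ℝ))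
              + C / (S.card : ℝ)}) ∧
    (∃ b₀ : ℝ, 0 < b₀ ∧ ∀ b : ℝ, b₀ ≤ b → ∃ C : ℝ, 0 < C ∧
      ∀ (Ω : Type*) (m : MeasurableSpace Ω) (μ : Measure Ω) (_ : IsProbabilityMeasure μ)
        (ℱ : Filtration ℕ m) (K : ℕ) (ν : Fin K → Measure (ℝ × ℝ)) (u τ : Fin K → ℕ → Ω → ℝ)
        (I : ℕ → Ω → Fin K) (L : ℝ) (σu στ : ℝ≥0),
      0 < L → 0 < max σu στ → (∀ i, IsProviderLaw (ν i) σu στ) →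
      IsStationaryFeedback μ ℱ ν u τ →
      IsScoreRouter ℱ L (b * (1 + L⁻¹) * (max σu στ : ℝ)) 0 u τ I →
      ∃ g : ℕ → ℝ, g =o[Filter.atTop] (fun T : ℕ => Real.log (T : ℝ)) ∧
        ∀ T : ℕ, regret L ν μ I T ≤
          (∑ i ∈ Finset.univ.filter (fun i => 0 < valueGap L ν i),
            C * (1 + L⁻¹) ^ 2 * (max σu στ : ℝ) ^ 2 * Real.log (T : ℝ) / valueGap L ν i)
          + g T) := by
  refine ⟨fun Ω m μ _ ℱ K ν u τ L σu στ hL hν hf i => hf.exists_concentration hν hL i, 4,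
    by norm_num, fun b hb => ⟨4 * b ^ 2, by positivity, ?_⟩⟩
  intro Ω m μ _ ℱ K ν u τ I L σu στ hL hσ hν hf hr
  obtain ⟨G, hG⟩ := hr.regret_le hf hν hL hσ hb
  refine ⟨fun _ => G, ?_, hG⟩
  exact Asymptotics.isLittleO_const_left.2 (Or.inr (tendsto_norm_atTop_atTop.comp
    (Real.tendsto_log_atTop.comp tendsto_natCast_atTop_atTop)))
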